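/- Let $\mu$ be a Borel probability measure on the unit circle $\mathbb T=\{z\in\mathbb C:|z|=1\}$ that is not concentrated on a finite set, and put $\langle f,g\rangle=\int_{\mathbb T}\overline{f(z)}\,g(z)\,d\mu(z)$. Let $\Phi_n$ and $\varphi_n=\Phi_n/\|\Phi_n\|$ ($n\ge 0$) be the monic and the orthonormal Szegő polynomials of $\mu$, obtained from $1,z,z^2,\dots$ by the Gram–Schmidt process. Let $\alpha_k=-\overline{\Phi_{k+1}(0)}$ and $\rho_k=\sqrt{1-|\alpha_k|^2}$ ($k\ge 0$) be the Schur parameters and the complementary Schur parameters. Let $G_{k,k+1}$ be the infinite matrix (rows and columns indexed from $0$) that equals the identity except for the block $$\tilde G_{k,k+1}=\begin{pmatrix}\overline{\alpha_k}&\rho_k\\ \rho_k&-\alpha_k\end{pmatrix}$$ in rows and columns $k,k+1$. Let $\{p_k\}_{k\ge 0}$ be a generating sequence, i.e. a sequence of integers with $p_0=0$, $0\le p_k\le k$ and $s_k:=p_k-p_{k-1}\in\{0,1\}$ for $k\ge 1$. The associated snake-shaped matrix factorization is the infinite product $\mathcal S=\prod_{k\ge0}G_{k,k+1}$ defined as the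 entrywise limit of the matrices $\mathcal S^{(k)}$, where $\mathcal S^{(0)}=G_{0,1}$ and, for $k\ge 1$, $\mathcal S^{(k)}=\mathcal S^{(k-1)}G_{k,k+1}$ if $s_k=0$ and $\mathcal S^{(k)}=G_{k,k+1}\mathcal S^{(k-1)}$ if $s_k=1$ (each entry is eventually constant). Then, for every generating sequence and every integer $n\ge 1$: 1. The eigenvalues of the principal $n\times n$ submatrix of $\mathcal S$ (rows and columns $0,\dots,n-1$) are the zeros of the Szegő polynomial $\varphi_n$, also when both are counted with their (algebraic) multiplicities. 2. Let $\theta,\tilde\theta\in\mathbb R$, and let $\mathcal S_{n-1}$ be the $n\times n$ matrix formed by the rows and columns $0,\dots,n-1$ of the snake-shaped product in which the block $\tilde G_{n-1,n}$ is replaced by $\mathrm{diag}(e^{i\theta},e^{i\tilde\theta})$, all other factors and the order of the factors being unchanged. Then $\mathcal S_{n-1}$ has $n$ distinct eigenvalues $z_1,\dots,z_n$, all on $\mathbb T$. It has a system of normalized eigenvectors, i.e. an orthonormal system $v_1,\dots,v_n$ with $\mathcal S_{n-1}v_j=z_jv_j$ such that the first component $c_j$ of each $v_j$ is real and positive. For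 every such system, the nodes $z_j$ and the weights $\lambda_j=c_j^2$, the squares of the first components of the normalized eigenvectors, form an $n$-point Szegő quadrature formula for $\mu$: $$\sum_{j=1}^n\lambda_j L(z_j)=\int_{\mathbb T}L\,d\mu\qquad\text{for all }L\in\mathrm{span}\{z^k:-n+1\le k\le n-1\}.$$ -/

import Mathlib

open MeasureTheory Filter Topology Polynomial

noncomputable section

namespace Szego

/-- The unit circle carries its Borel σ-algebra. -/
instance : MeasurableSpace Circle := borel Circle

instance : BorelSpace Circle := ⟨rfl⟩

/-- The inner product `⟨p, q⟩ = ∫ conj (p z) * q z dμ(z)` of two polynomials,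
for a measure `μ` on the unit circle. -/
def ip (μ : Measure Circle) (p q : ℂ[X]) : ℂ :=
  ∫ z : Circle, (starRingEnd ℂ) (p.eval (z : ℂ)) * q.eval (z : ℂ) ∂μ

/-- The monic Szegő polynomials `Φ n`: the (unnormalised) Gram-Schmidt process applied to
`1, z, z ^ 2, …` with respect to `⟨·, ·⟩`. -/
def monicPoly (μ : Measure Circle) (n : ℕ) : ℂ[X] :=
  X ^ n - ∑ k : Fin n,
    C (ip μ (monicPoly μ k) (X ^ n) / ip μ (monicPoly μ k) (monicPoly μ k)) * monicPoly μ k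
termination_by n
decreasing_by all_goals exact k.2

/-- The orthonormal Szegő polynomials `φ n = Φ n / ‖Φ n‖`. -/
def orthoPoly (μ : Measure Circle) (n : ℕ) : ℂ[X] :=
  C (((Real.sqrt (∫ z : Circle, ‖(monicPoly μ n).eval (z : ℂ)‖ ^ 2 ∂μ))⁻¹ : ℝ) : ℂ) *
    monicPoly μ n

/-- The Schur parameters (Verblunsky coefficients) `α k = - conj (Φ (k + 1) 0)`. This is the
value at `z = 0` of the Szegő recursion `z φ_k = conj (α k) φ_k^* + ρ_k φ_{k+1}`. -/
def schurParam (μ : Measure Circle) (k : ℕ) : ℂ :=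
  -(starRingEnd ℂ) ((monicPoly μ (k + 1)).eval 0)

/-- The complementary Schur parameters `ρ k = √(1 - |α k| ^ 2)`. -/
def rho (μ : Measure Circle) (k : ℕ) : ℝ :=
  Real.sqrt (1 - ‖schurParam μ k‖ ^ 2)

/-- The non-trivial 2 × 2 block of the `k`-th Givens transformation. -/
def schurBlock (μ : Measure Circle) (k : ℕ) : Matrix (Fin 2) (Fin 2) ℂ :=
  !![(starRingEnd ℂ) (schurParam μ k), (rho μ k : ℂ);
     (rho μ k : ℂ), -schurParam μ k]

/-- A generating sequence: `p 0 = 0`, `0 ≤ p n ≤ n`, and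
`s n = p n - p (n - 1) ∈ {0, 1}` for `n ≥ 1`. -/
structure IsGeneratingSequence (p : ℕ → ℕ) : Prop where
  zero : p 0 = 0
  le : ∀ n, p n ≤ n
  step : ∀ n, p (n + 1) = p n ∨ p (n + 1) = p n + 1

/-- The product of two infinite matrices. (In every product formed below, one of the factors
has at most two non-zero entries in each row and in each column, so all sums are finite.) -/
def infMul (A B : Matrix ℕ ℕ ℂ) : Matrix ℕ ℕ ℂ :=
  fun i j => ∑' k, A i k * B k j

/-- The infinite matrix `G_{k,k+1}`, equal to the identity matrix except for the 2 × 2 block `M`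
in the rows and columns `k, k + 1`. -/
def givens (k : ℕ) (M : Matrix (Fin 2) (Fin 2) ℂ) : Matrix ℕ ℕ ℂ :=
  fun i j =>
    if i = k ∧ j = k then M 0 0
    else if i = k ∧ j = k + 1 then M 0 1
    else if i = k + 1 ∧ j = k then M 1 0
    else if i = k + 1 ∧ j = k + 1 then M 1 1
    else if i = j then 1 else 0

/-- The iterates `S^(k)` of the snake with shape `p` and segments `g`: `S^(0) = G_{0,1}`, and
`S^(k) = S^(k-1) G_{k,k+1}` if `s k = 0`, `S^(k) = G_{k,k+1} S^(k-1)` if `s k = 1`. -/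
def partialSnake (p : ℕ → ℕ) (g : ℕ → Matrix (Fin 2) (Fin 2) ℂ) : ℕ → Matrix ℕ ℕ ℂ
  | 0 => givens 0 (g 0)
  | k + 1 =>
    if p (k + 1) = p k then infMul (partialSnake p g k) (givens (k + 1) (g (k + 1)))
    else infMul (givens (k + 1) (g (k + 1))) (partialSnake p g k)

/-- The infinite snake-shaped product `S = ∏ G_{k,k+1}`: the entrywise limit of the iterates.
It always exists, see `partialSnake_eventually`. -/
def snake (p : ℕ → ℕ) (g : ℕ → Matrix (Fin 2) (Fin 2) ℂ) : Matrix ℕ ℕ ℂ :=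
  fun i j => limUnder atTop (fun k => partialSnake p g k i j)

lemma partialSnake_succ (p : ℕ → ℕ) (g : ℕ → Matrix (Fin 2) (Fin 2) ℂ) {k i j : ℕ}
    (hi : i ≤ k) (hj : j ≤ k) : partialSnake p g (k + 1) i j = partialSnake p g k i j := by
  rw [partialSnake]
  split_ifs with h
  · unfold infMul
    rw [tsum_eq_single j]
    · have : givens (k + 1) (g (k + 1)) j j = 1 := by
        unfold givens; split_ifs <;> first | omega | rfl
      rw [this, mul_one]
    · intro m hm
      have : givens (k + 1) (g (k + 1)) m j = 0 := by
        unfold givens; split_ifs <;> first | omega | rfl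
      rw [this, mul_zero]
  · unfold infMul
    rw [tsum_eq_single i]
    · have : givens (k + 1) (g (k + 1)) i i = 1 := by
        unfold givens; split_ifs <;> first | omega | rfl
      rw [this, one_mul]
    · intro m hm
      have : givens (k + 1) (g (k + 1)) i m = 0 := by
        unfold givens; split_ifs <;> first | omega | rfl
      rw [this, zero_mul]

/-- Every entry of the iterates is eventually constant, equal to the entry of `snake`. -/
lemma partialSnake_eventually (p : ℕ → ℕ) (g : ℕ → Matrix (Fin 2) (Fin 2) ℂ) {k i j : ℕ}
    (hi : i ≤ k) (hj : j ≤ k) : partialSnake p g k i j = snake p g i j := by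
  have key : ∀ m, partialSnake p g (k + m) i j = partialSnake p g k i j := by
    intro m
    induction m with
    | zero => rfl
    | succ m ih => rw [← add_assoc, partialSnake_succ p g (by omega) (by omega), ih]
  have ht : Tendsto (fun m => partialSnake p g m i j) atTop (𝓝 (partialSnake p g k i j)) := by
    refine tendsto_const_nhds.congr' ?_
    filter_upwards [eventually_ge_atTop k] with m hm
    obtain ⟨d, rfl⟩ := Nat.exists_eq_add_of_le hm
    exact (key d).symm
  exact ht.limUnder_eq.symm

/-- The principal `n × n` submatrix (rows and columns `0, …, n - 1`). -/
def principal (A : Matrix ℕ ℕ ℂ) (n : ℕ) : Matrix (Fin n) (Fin n) ℂ :=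
  A.submatrix (fun i => (i : ℕ)) (fun j => (j : ℕ))

/-- The snake-shaped matrix factorization of the measure `μ` with shape `p`. -/
def snakeMatrix (μ : Measure Circle) (p : ℕ → ℕ) : Matrix ℕ ℕ ℂ :=
  snake p (schurBlock μ)

/-- The segments of the broken snake: the block of `G_{n-1,n}` is replaced by
`diag (e^{iθ}, e^{iθ'})`. -/
def brokenBlock (μ : Measure Circle) (n : ℕ) (θ θ' : ℝ) : ℕ → Matrix (Fin 2) (Fin 2) ℂ :=
  Function.update (schurBlock μ) (n - 1)
    !![Complex.exp (θ * Complex.I), 0; 0, Complex.exp (θ' * Complex.I)]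

/-- The unitary truncation `S_{n-1}`, of size `n × n`: the top block, in the rows and columns
`0, …, n - 1`, of the broken snake. -/
def truncation (μ : Measure Circle) (p : ℕ → ℕ) (n : ℕ) (θ θ' : ℝ) :
    Matrix (Fin n) (Fin n) ℂ :=
  principal (snake p (brokenBlock μ n θ θ')) n

/-- The nodes `z j` (distinct points of the unit circle) and the weights `w j` form an `n`-point
Szegő quadrature formula for `μ`: it is exact on `span {z ^ k : -n + 1 ≤ k ≤ n - 1}`. -/
structure IsSzegoQuadrature (μ : Measure Circle) (n : ℕ) (z : Fin n → Circle)
    (w : Fin n → ℝ) : Prop where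
  distinct : Function.Injective z
  exact_on : ∀ L ∈ Submodule.span ℂ
      {f : Circle → ℂ | ∃ k : ℤ, -(n : ℤ) + 1 ≤ k ∧ k ≤ (n : ℤ) - 1 ∧
        f = fun x : Circle => (x : ℂ) ^ k},
    ∑ j, (w j : ℂ) * L (z j) = ∫ x, L x ∂μ

/-- `v` is a system of normalised eigenvectors of `U` for the eigenvalues `z`: it is orthonormal,
and the first components are the positive real numbers `c j`. -/
structure IsNormalizedEigensystem {n : ℕ} (hn : 0 < n) (U : Matrix (Fin n) (Fin n) ℂ)
    (z : Fin n → ℂ) (v : Fin n → EuclideanSpace ℂ (Fin n)) (c : Fin n → ℝ) : Prop where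
  orthonormal : Orthonormal ℂ v
  eigen : ∀ j, U.mulVec (fun i => v j i) = fun i => z j * v j i
  pos : ∀ j, 0 < c j
  first : ∀ j, v j ⟨0, hn⟩ = (c j : ℂ)

end Szego

end

/-!
Write `φ_k^*` for the reversed polynomials. The Szegő recursion, which follows from the
orthogonality of `Φ_n^*` to `z, …, z ^ n` (`monicPoly_succ`), says
`(φ_k^*, φ_{k+1}) G̃_{k,k+1} = (z φ_k, φ_{k+1}^*)`. Inserting the Givens transformations one after
the other, on the right or on the left as the shape `p` demands, shows that the row vector with the
components `z ^ (-p_k) φ_k` (if `s_k = 0`) or `z ^ (-p_k) φ_k^*` (if `s_k = 1`) is a formal row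
eigenvector of the snake for the eigenvalue `z`. If the upper left entry of the last block is
replaced by `β`, then the cut-off vector is a true row eigenvector of the `n × n` submatrix exactly
when `z` is a zero of `P_β = z Φ_{n-1} - β Φ_{n-1}^*` (`vecMul_szegoRow`).

For `|β| = 1` the submatrix is unitary, so the zeros of `P_β` lie on the circle. They are simple:
`P_β` is orthogonal to `z, …, z ^ (n-1)`, and a double zero `w` would give a test polynomial
against which the integrand has the constant phase of `-w` (`not_sq_dvd_paraPoly`). Hence the
characteristic polynomial is `P_β`. Both of these are affine in `β`, so they agree for all `β`
(`charpoly_principal_snake`), and `β = conj α_{n-1}` gives `P_β = Φ_n`, the statement on the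
principal submatrices.

For the quadrature formula, the conjugated row vectors are eigenvectors of the unitary truncation.
On the circle the moduli of their components are `|φ_k|`, for every shape. So the first components
of the normalized eigenvectors are `c_j = (∑_{k<n} |φ_k(z_j)| ^ 2) ^ (-1/2)`, independently of `p`,
and the shape `p = 0` may be used to compute with them. There the eigenvector matrix has the
entries `c_j conj (φ_k(z_j))`; as it is unitary,
`∑_j c_j ^ 2 conj (φ_k(z_j)) φ_l(z_j) = δ_{kl} = ⟨φ_k, φ_l⟩`, and the products `conj f * g` with
`f`, `g` of degree less than `n` span the required Laurent polynomials.
-/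

noncomputable section

namespace Szego

/-! ### The inner product on polynomials -/

section InnerProduct

variable (μ : Measure Circle)

lemma continuous_eval_circle (p : ℂ[X]) : Continuous fun z : Circle => p.eval (z : ℂ) :=
  p.continuous.comp continuous_subtype_val

lemma integrable_of_continuous [IsFiniteMeasure μ] {E : Type*} [NormedAddCommGroup E]
    {f : Circle → E} (hf : Continuous f) : Integrable f μ :=
  hf.integrable_of_hasCompactSupport (HasCompactSupport.of_compactSpace f)

lemma continuous_ip_integrand (p q : ℂ[X]) :
    Continuous fun z : Circle => (starRingEnd ℂ) (p.eval (z : ℂ)) * q.eval (z : ℂ) :=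
  (Complex.continuous_conj.comp (continuous_eval_circle p)).mul (continuous_eval_circle q)

lemma conj_ip (p q : ℂ[X]) : (starRingEnd ℂ) (ip μ p q) = ip μ q p := by
  unfold ip
  rw [← integral_conj]
  congr 1
  ext z
  simp [mul_comm]

lemma ip_C_mul_right (p q : ℂ[X]) (c : ℂ) : ip μ p (C c * q) = c * ip μ p q := by
  unfold ip
  rw [← integral_const_mul]
  congr 1
  ext z
  simp only [eval_mul, eval_C]
  ring

lemma ip_zero_right (p : ℂ[X]) : ip μ p 0 = 0 := by simp [ip]

lemma ip_C_mul_left (p q : ℂ[X]) (c : ℂ) :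
    ip μ (C c * p) q = (starRingEnd ℂ) c * ip μ p q := by
  rw [← conj_ip, ip_C_mul_right, map_mul, conj_ip]

lemma ip_zero_left (q : ℂ[X]) : ip μ 0 q = 0 := by simp [ip]

lemma ip_self (p : ℂ[X]) : ip μ p p = ((∫ z : Circle, ‖p.eval (z : ℂ)‖ ^ 2 ∂μ : ℝ) : ℂ) := by
  refine (integral_congr_ae (ae_of_all _ fun z => ?_)).trans integral_ofReal
  simp only [RCLike.conj_mul]
  norm_cast

variable [IsFiniteMeasure μ]

lemma ip_add_right (p q r : ℂ[X]) : ip μ p (q + r) = ip μ p q + ip μ p r := by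
  unfold ip
  rw [← integral_add (integrable_of_continuous μ (continuous_ip_integrand p q))
    (integrable_of_continuous μ (continuous_ip_integrand p r))]
  simp only [eval_add, mul_add]

lemma ip_sub_right (p q r : ℂ[X]) : ip μ p (q - r) = ip μ p q - ip μ p r := by
  have := ip_add_right μ p q (C (-1) * r)
  rw [ip_C_mul_right] at this
  rw [sub_eq_add_neg, sub_eq_add_neg, ← neg_one_mul (ip μ p r), ← this]
  simp

lemma ip_add_left (p q r : ℂ[X]) : ip μ (p + q) r = ip μ p r + ip μ q r := by
  rw [← conj_ip, ip_add_right, map_add, conj_ip, conj_ip]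

lemma ip_sum_right {ι : Type*} (s : Finset ι) (p : ℂ[X]) (f : ι → ℂ[X]) :
    ip μ p (∑ i ∈ s, f i) = ∑ i ∈ s, ip μ p (f i) := by
  classical
  induction s using Finset.induction_on with
  | empty => simp [ip_zero_right]
  | insert a s ha ih => rw [Finset.sum_insert ha, Finset.sum_insert ha, ip_add_right, ih]

variable {μ}

/-- A polynomial that vanishes `μ`-almost everywhere is zero, as `μ` is not concentrated on the
finite set of its zeros. -/
lemma eq_zero_of_integral_sq_eq_zero (hμ : ∀ s : Set Circle, s.Finite → μ sᶜ ≠ 0) {p : ℂ[X]}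
    (h : ∫ z : Circle, ‖p.eval (z : ℂ)‖ ^ 2 ∂μ = 0) : p = 0 := by
  by_contra hp
  have h := (integral_eq_zero_iff_of_nonneg (fun z => sq_nonneg _)
    (integrable_of_continuous μ ((continuous_eval_circle p).norm.pow 2))).1 h
  refine hμ {z : Circle | p.eval (z : ℂ) = 0} ?_ ?_
  · refine Set.Finite.of_finite_image (f := fun z : Circle => (z : ℂ)) ?_
      Subtype.val_injective.injOn
    refine (p.rootSet_finite ℂ).subset ?_
    rintro _ ⟨z, hz, rfl⟩
    rw [mem_rootSet]
    exact ⟨hp, by simpa using hz⟩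
  · refine measure_mono_null ?_ (ae_iff.1 h)
    intro z hz
    simpa using hz

lemma integral_sq_pos (hμ : ∀ s : Set Circle, s.Finite → μ sᶜ ≠ 0) {p : ℂ[X]} (hp : p ≠ 0) :
    0 < ∫ z : Circle, ‖p.eval (z : ℂ)‖ ^ 2 ∂μ :=
  lt_of_le_of_ne (integral_nonneg fun _ => by positivity)
    fun h => hp (eq_zero_of_integral_sq_eq_zero hμ h.symm)

lemma eq_zero_of_ip_self (hμ : ∀ s : Set Circle, s.Finite → μ sᶜ ≠ 0) {p : ℂ[X]}
    (h : ip μ p p = 0) : p = 0 := by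
  rw [ip_self, Complex.ofReal_eq_zero] at h
  exact eq_zero_of_integral_sq_eq_zero hμ h

end InnerProduct

/-! ### Monic Szegő polynomials -/

lemma degree_C_mul_le (c : ℂ) (p : ℂ[X]) : (C c * p).degree ≤ p.degree := by
  rw [← smul_eq_C_mul]
  exact degree_smul_le c p

section Monic

variable (μ : Measure Circle)

lemma monicPoly_monic_and_degree (n : ℕ) :
    (monicPoly μ n).Monic ∧ (monicPoly μ n).degree = n := by
  induction n using Nat.strong_induction_on with
  | _ n ih =>
    have h : (∑ k : Fin n, C (ip μ (monicPoly μ k) (X ^ n) /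
        ip μ (monicPoly μ k) (monicPoly μ k)) * monicPoly μ k).degree < n := by
      refine lt_of_le_of_lt (degree_sum_le _ _) ?_
      refine (Finset.sup_lt_iff (WithBot.bot_lt_coe n)).2 fun k _ => ?_
      refine lt_of_le_of_lt ((degree_C_mul_le _ _)) ?_
      rw [(ih k k.2).2]
      exact WithBot.coe_lt_coe.2 k.2
    refine ⟨?_, ?_⟩
    · rw [monicPoly]
      exact (monic_X_pow n).sub_of_left (by rwa [degree_X_pow])
    · rw [monicPoly, degree_sub_eq_left_of_degree_lt (by rwa [degree_X_pow]), degree_X_pow]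

lemma monicPoly_monic (n : ℕ) : (monicPoly μ n).Monic := (monicPoly_monic_and_degree μ n).1

lemma degree_monicPoly (n : ℕ) : (monicPoly μ n).degree = n := (monicPoly_monic_and_degree μ n).2

lemma monicPoly_zero : monicPoly μ 0 = 1 := by
  rw [monicPoly]
  simp

/-- The polynomials `Φ k`, `k < n`, span the polynomials of degree `< n`. -/
lemma monicPoly_induction {P : ℂ[X] → Prop} (n : ℕ) (h0 : P 0)
    (hadd : ∀ f g, P f → P g → P (f + g)) (hmul : ∀ (c : ℂ) f, P f → P (C c * f))
    (hΦ : ∀ k < n, P (monicPoly μ k)) : ∀ f : ℂ[X], f.degree < n → P f := by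
  induction n with
  | zero =>
    intro f hf
    have : f = 0 := by
      rw [← degree_eq_bot]
      exact Nat.WithBot.lt_zero_iff.1 hf
    rwa [this]
  | succ n ih =>
    intro f hf
    have key : (f - C (f.coeff n) * monicPoly μ n).degree < n := by
      rw [degree_lt_iff_coeff_zero]
      intro m hm
      rcases hm.eq_or_lt with rfl | hm
      · have := (monicPoly_monic μ n).coeff_natDegree
        rw [natDegree_eq_of_degree_eq_some (degree_monicPoly μ n)] at this
        simp [this]
      · have h1 := (degree_lt_iff_coeff_zero f (n + 1)).1 hf m hm
        have h2 := coeff_eq_zero_of_degree_lt (p := monicPoly μ n) (n := m)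
          (by rw [degree_monicPoly]; exact_mod_cast hm)
        simp [h1, h2]
    have := hadd _ _ (ih (fun k hk => hΦ k (hk.trans n.lt_succ_self)) _ key)
      (hmul (f.coeff n) _ (hΦ n n.lt_succ_self))
    simpa using this

variable {μ} [IsFiniteMeasure μ]

lemma ip_monicPoly_monicPoly (hμ : ∀ s : Set Circle, s.Finite → μ sᶜ ≠ 0) (n : ℕ) :
    ∀ j < n, ip μ (monicPoly μ j) (monicPoly μ n) = 0 := by
  induction n using Nat.strong_induction_on with
  | _ n ih =>
    intro j hj
    rw [monicPoly.eq_1 μ n, ip_sub_right, ip_sum_right, Finset.sum_eq_single ⟨j, hj⟩]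
    · have : ip μ (monicPoly μ j) (monicPoly μ j) ≠ 0 :=
        fun h => (monicPoly_monic μ j).ne_zero (eq_zero_of_ip_self hμ h)
      rw [ip_C_mul_right]
      simp [this]
    · intro k _ hk
      have hk' : (k : ℕ) ≠ j := fun h => hk (Fin.ext h)
      rw [ip_C_mul_right]
      rcases lt_or_gt_of_ne hk' with h | h
      · rw [← conj_ip μ (monicPoly μ k) (monicPoly μ j), ih j hj k h]
        simp
      · rw [ih k k.2 j h, mul_zero]
    · simp

lemma ip_monicPoly_of_degree_lt (hμ : ∀ s : Set Circle, s.Finite → μ sᶜ ≠ 0) {n : ℕ} {f : ℂ[X]}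
    (hf : f.degree < n) : ip μ f (monicPoly μ n) = 0 := by
  refine monicPoly_induction μ (P := fun f => ip μ f (monicPoly μ n) = 0) n ?_ ?_ ?_ ?_ f hf
  · exact ip_zero_left μ _
  · intro f g hf hg
    rw [ip_add_left, hf, hg, add_zero]
  · intro c f hf
    rw [ip_C_mul_left, hf, mul_zero]
  · exact ip_monicPoly_monicPoly hμ n

end Monic

/-! ### The Szegő recursion -/

section Recursion

/-- The reversed polynomials `Φ_n^*(z) = z ^ n * conj (Φ_n (1 / conj z))`, defined through the
second half of the Szegő recursion, `Φ_{n+1}^* = Φ_n^* - α_n z Φ_n`. -/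
def revPoly (μ : Measure Circle) : ℕ → ℂ[X]
  | 0 => 1
  | n + 1 => revPoly μ n - C (schurParam μ n) * (X * monicPoly μ n)

/-- The norm `‖Φ_n‖` in `L²(μ)`. -/
def monicNorm (μ : Measure Circle) (n : ℕ) : ℝ :=
  Real.sqrt (∫ z : Circle, ‖(monicPoly μ n).eval (z : ℂ)‖ ^ 2 ∂μ)

/-- The reversed orthonormal polynomials `φ_n^* = Φ_n^* / ‖Φ_n‖`. -/
def orthoRevPoly (μ : Measure Circle) (n : ℕ) : ℂ[X] :=
  C (((monicNorm μ n)⁻¹ : ℝ) : ℂ) * revPoly μ n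

variable (μ : Measure Circle)

lemma degree_revPoly_lt (n : ℕ) : (revPoly μ n).degree < ((n + 1 : ℕ) : WithBot ℕ) := by
  induction n with
  | zero => simp [revPoly, degree_one]
  | succ n ih =>
    refine lt_of_le_of_lt (degree_sub_le _ _) (max_lt ?_ ?_)
    · exact ih.trans (by exact_mod_cast Nat.lt_succ_self _)
    · refine lt_of_le_of_lt ((degree_C_mul_le _ _)) ?_
      rw [degree_mul, degree_X, degree_monicPoly, add_comm]
      exact_mod_cast Nat.lt_succ_self _

lemma revPoly_eval_zero (n : ℕ) : (revPoly μ n).eval 0 = 1 := by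
  induction n with
  | zero => simp [revPoly]
  | succ n ih => simp [revPoly, ih]

lemma circle_conj_mul (z : Circle) : (starRingEnd ℂ) (z : ℂ) * z = 1 := by
  rw [RCLike.conj_mul]
  have : ‖(z : ℂ)‖ = 1 := Circle.norm_coe z
  simp [this]

/-- The reversal identity on the circle makes `Φ_n^*` orthogonal to `z, …, z ^ n`. -/
lemma ip_X_mul_revPoly [IsFiniteMeasure μ] (hμ : ∀ s : Set Circle, s.Finite → μ sᶜ ≠ 0) {n : ℕ}
    (hrev : ∀ z : Circle, (revPoly μ n).eval (z : ℂ) =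
      (z : ℂ) ^ n * (starRingEnd ℂ) ((monicPoly μ n).eval (z : ℂ)))
    {f : ℂ[X]} (hf : f.degree < n) : ip μ (X * f) (revPoly μ n) = 0 := by
  rcases eq_or_ne f 0 with rfl | hf0
  · rw [mul_zero, ip_zero_left]
  -- By linearity in `f`, it suffices to take monomials, for which the claim is
  -- `⟨Φ_n, z ^ (n - 1 - k)⟩ = 0`.
  rw [f.as_sum_range' n ((natDegree_lt_iff_degree_lt hf0).2 hf), ← conj_ip, Finset.mul_sum,
    ip_sum_right, Finset.sum_eq_zero, map_zero]
  intro k hk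
  rw [Finset.mem_range] at hk
  rw [← C_mul_X_pow_eq_monomial, mul_left_comm, ip_C_mul_right]
  have hlt : ((X : ℂ[X]) ^ (n - 1 - k)).degree < n := by
    rw [degree_X_pow]
    exact_mod_cast (by omega : n - 1 - k < n)
  have h0 := ip_monicPoly_of_degree_lt hμ hlt
  have heq : ip μ (X * X ^ k) (revPoly μ n) = ip μ (monicPoly μ n) (X ^ (n - 1 - k)) := by
    unfold ip
    congr 1
    ext z
    have hz := circle_conj_mul z
    rw [hrev]
    simp only [map_mul, map_pow, eval_mul, eval_X, eval_pow]
    obtain ⟨d, rfl⟩ : ∃ d, n = k + 1 + d := ⟨n - (k + 1), by omega⟩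
    have : k + 1 + d - 1 - k = d := by omega
    rw [this]
    calc _ = ((starRingEnd ℂ) (z : ℂ) * z) ^ (k + 1) * ((starRingEnd ℂ)
        ((monicPoly μ (k + 1 + d)).eval (z : ℂ)) * (z : ℂ) ^ d) := by ring
      _ = _ := by rw [hz, one_pow, one_mul]
  rw [← conj_ip, heq, conj_ip, h0, mul_zero]

lemma degree_X_mul_monicPoly (n : ℕ) : (X * monicPoly μ n).degree = ((n + 1 : ℕ) : WithBot ℕ) := by
  rw [degree_mul, degree_X, degree_monicPoly, add_comm]
  rfl

lemma ip_X_mul_X_mul (f g : ℂ[X]) : ip μ (X * f) (X * g) = ip μ f g := by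
  unfold ip
  congr 1
  ext z
  simp only [map_mul, eval_mul, eval_X]
  linear_combination ((starRingEnd ℂ) (f.eval (z : ℂ)) * g.eval (z : ℂ)) * circle_conj_mul z

lemma orthoPoly_eq (n : ℕ) :
    orthoPoly μ n = C (((monicNorm μ n)⁻¹ : ℝ) : ℂ) * monicPoly μ n := rfl

variable [IsFiniteMeasure μ]

/-- The difference of the two sides has no constant term, hence is a multiple of `z`; and it is
orthogonal to `z, …, z ^ n`, hence to itself. -/
lemma monicPoly_succ_of_revPoly (hμ : ∀ s : Set Circle, s.Finite → μ sᶜ ≠ 0) {n : ℕ}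
    (hrev : ∀ z : Circle, (revPoly μ n).eval (z : ℂ) =
      (z : ℂ) ^ n * (starRingEnd ℂ) ((monicPoly μ n).eval (z : ℂ))) :
    monicPoly μ (n + 1) =
      X * monicPoly μ n - C ((starRingEnd ℂ) (schurParam μ n)) * revPoly μ n := by
  set h : ℂ[X] := X * monicPoly μ n - monicPoly μ (n + 1) -
    C ((starRingEnd ℂ) (schurParam μ n)) * revPoly μ n with hh
  have hdeg : h.degree < ((n + 1 : ℕ) : WithBot ℕ) := by
    refine lt_of_le_of_lt (degree_sub_le _ _) (max_lt ?_
      ((degree_C_mul_le _ _).trans_lt (degree_revPoly_lt μ n)))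
    refine (degree_sub_lt_left ?_ ?_ ?_).trans_eq (degree_X_mul_monicPoly μ n)
    · rw [degree_X_mul_monicPoly, degree_monicPoly]
    · exact mul_ne_zero X_ne_zero (monicPoly_monic μ n).ne_zero
    · rw [(monicPoly_monic μ (n + 1)).leadingCoeff,
        (monic_X.mul (monicPoly_monic μ n)).leadingCoeff]
  have h0 : h.coeff 0 = 0 := by
    rw [coeff_zero_eq_eval_zero, hh]
    simp [revPoly_eval_zero, schurParam]
  obtain ⟨f, hf⟩ := X_dvd_iff.2 h0
  have hfdeg : f.degree < n := by
    rcases eq_or_ne f 0 with rfl | hf0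
    · rw [degree_zero]
      exact WithBot.bot_lt_coe n
    · rw [hf, degree_mul, degree_X, degree_eq_natDegree hf0] at hdeg
      rw [degree_eq_natDegree hf0]
      norm_cast at hdeg ⊢
      omega
  have hself : ip μ h h = 0 := by
    nth_rewrite 1 [hf]
    have hX : (X * f).degree < ((n + 1 : ℕ) : WithBot ℕ) := hf ▸ hdeg
    rw [hh, ip_sub_right, ip_sub_right, ip_C_mul_right, ip_X_mul_revPoly μ hμ hrev hfdeg,
      ip_X_mul_X_mul, ip_monicPoly_of_degree_lt hμ hfdeg, ip_monicPoly_of_degree_lt hμ hX]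
    ring
  have := eq_zero_of_ip_self hμ hself
  rw [hh] at this
  linear_combination -this

lemma revPoly_eval_circle (hμ : ∀ s : Set Circle, s.Finite → μ sᶜ ≠ 0) (n : ℕ) (z : Circle) :
    (revPoly μ n).eval (z : ℂ) =
      (z : ℂ) ^ n * (starRingEnd ℂ) ((monicPoly μ n).eval (z : ℂ)) := by
  induction n generalizing z with
  | zero => simp [revPoly, monicPoly_zero]
  | succ n ih =>
    have hz := circle_conj_mul z
    rw [monicPoly_succ_of_revPoly μ hμ ih, revPoly]
    simp only [eval_sub, eval_mul, eval_C, eval_X, map_sub, map_mul, Complex.conj_conj, ih,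
      map_pow]
    have hzn : (starRingEnd ℂ) (z : ℂ) ^ n * (z : ℂ) ^ n = 1 := by rw [← mul_pow, hz, one_pow]
    linear_combination (-(z : ℂ) ^ n * (starRingEnd ℂ) ((monicPoly μ n).eval (z : ℂ))) * hz +
      schurParam μ n * (z : ℂ) * (monicPoly μ n).eval (z : ℂ) * hzn

/-- The Szegő recursion. -/
lemma monicPoly_succ (hμ : ∀ s : Set Circle, s.Finite → μ sᶜ ≠ 0) (n : ℕ) :
    monicPoly μ (n + 1) =
      X * monicPoly μ n - C ((starRingEnd ℂ) (schurParam μ n)) * revPoly μ n :=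
  monicPoly_succ_of_revPoly μ hμ (revPoly_eval_circle μ hμ n)

lemma norm_revPoly_eval_circle (hμ : ∀ s : Set Circle, s.Finite → μ sᶜ ≠ 0) (n : ℕ)
    (z : Circle) : ‖(revPoly μ n).eval (z : ℂ)‖ = ‖(monicPoly μ n).eval (z : ℂ)‖ := by
  have : ‖(z : ℂ)‖ = 1 := Circle.norm_coe z
  rw [revPoly_eval_circle μ hμ, norm_mul, norm_pow, this, RCLike.norm_conj, one_pow, one_mul]

lemma monicNorm_pos (hμ : ∀ s : Set Circle, s.Finite → μ sᶜ ≠ 0) (n : ℕ) :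
    0 < monicNorm μ n :=
  Real.sqrt_pos.2 (integral_sq_pos hμ (monicPoly_monic μ n).ne_zero)

/-- Pythagoras for `z Φ_n = Φ_{n+1} + conj α_n Φ_n^*`. -/
lemma monicNorm_succ_sq (hμ : ∀ s : Set Circle, s.Finite → μ sᶜ ≠ 0) (n : ℕ) :
    monicNorm μ (n + 1) ^ 2 = (1 - ‖schurParam μ n‖ ^ 2) * monicNorm μ n ^ 2 := by
  have hsq (k : ℕ) : ip μ (monicPoly μ k) (monicPoly μ k) = ((monicNorm μ k ^ 2 : ℝ) : ℂ) := by
    rw [ip_self, monicNorm, Real.sq_sqrt (integral_nonneg fun _ => by positivity)]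
  have hrev : ip μ (revPoly μ n) (revPoly μ n) = ip μ (monicPoly μ n) (monicPoly μ n) := by
    rw [ip_self, ip_self]
    simp only [norm_revPoly_eval_circle μ hμ]
  have h0 : ip μ (revPoly μ n) (monicPoly μ (n + 1)) = 0 :=
    ip_monicPoly_of_degree_lt hμ (degree_revPoly_lt μ n)
  have h0' : ip μ (monicPoly μ (n + 1)) (revPoly μ n) = 0 := by rw [← conj_ip, h0, map_zero]
  have h1 : ip μ (X * monicPoly μ n) (X * monicPoly μ n) = ip μ (monicPoly μ n) (monicPoly μ n) :=
    ip_X_mul_X_mul μ _ _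
  have hX : X * monicPoly μ n =
      monicPoly μ (n + 1) + C ((starRingEnd ℂ) (schurParam μ n)) * revPoly μ n := by
    rw [monicPoly_succ μ hμ]
    ring
  rw [hX, ip_add_left, ip_add_right, ip_add_right, ip_C_mul_left, ip_C_mul_left, ip_C_mul_right,
    ip_C_mul_right, h0, h0', hrev, hsq, hsq, Complex.conj_conj] at h1
  have h2 : schurParam μ n * (starRingEnd ℂ) (schurParam μ n) =
      ((‖schurParam μ n‖ ^ 2 : ℝ) : ℂ) := by
    rw [RCLike.mul_conj]
    norm_cast
  have h3 : ((monicNorm μ (n + 1) ^ 2 : ℝ) : ℂ) =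
      (((1 - ‖schurParam μ n‖ ^ 2) * monicNorm μ n ^ 2 : ℝ) : ℂ) := by
    rw [Complex.ofReal_mul, Complex.ofReal_sub, ← h2, Complex.ofReal_one]
    linear_combination h1
  exact_mod_cast h3

lemma one_sub_norm_schurParam_sq_pos (hμ : ∀ s : Set Circle, s.Finite → μ sᶜ ≠ 0) (n : ℕ) :
    0 < 1 - ‖schurParam μ n‖ ^ 2 := by
  have h := monicNorm_succ_sq μ hμ n
  have h1 := pow_pos (monicNorm_pos μ hμ (n + 1)) 2
  rw [h] at h1
  exact pos_of_mul_pos_left h1 (sq_nonneg _)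

lemma rho_pos (hμ : ∀ s : Set Circle, s.Finite → μ sᶜ ≠ 0) (n : ℕ) : 0 < rho μ n :=
  Real.sqrt_pos.2 (one_sub_norm_schurParam_sq_pos μ hμ n)

lemma rho_sq (hμ : ∀ s : Set Circle, s.Finite → μ sᶜ ≠ 0) (n : ℕ) :
    (rho μ n : ℂ) * rho μ n + schurParam μ n * (starRingEnd ℂ) (schurParam μ n) = 1 := by
  rw [RCLike.mul_conj]
  have : rho μ n * rho μ n = 1 - ‖schurParam μ n‖ ^ 2 :=
    Real.mul_self_sqrt (one_sub_norm_schurParam_sq_pos μ hμ n).le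
  rw [← Complex.ofReal_mul, this]
  push_cast
  exact sub_add_cancel _ _

lemma monicNorm_succ (hμ : ∀ s : Set Circle, s.Finite → μ sᶜ ≠ 0) (n : ℕ) :
    monicNorm μ (n + 1) = rho μ n * monicNorm μ n := by
  rw [rho, ← Real.sqrt_sq (monicNorm_pos μ hμ (n + 1)).le, monicNorm_succ_sq μ hμ,
    Real.sqrt_mul (one_sub_norm_schurParam_sq_pos μ hμ n).le,
    Real.sqrt_sq (monicNorm_pos μ hμ n).le]

lemma norm_orthoRevPoly_eval_circle (hμ : ∀ s : Set Circle, s.Finite → μ sᶜ ≠ 0) (n : ℕ)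
    (z : Circle) : ‖(orthoRevPoly μ n).eval (z : ℂ)‖ = ‖(orthoPoly μ n).eval (z : ℂ)‖ := by
  rw [orthoPoly_eq, orthoRevPoly, eval_mul, eval_mul, norm_mul, norm_mul,
    norm_revPoly_eval_circle μ hμ]

/-- The first column of `(φ_k^*, φ_{k+1}) G̃_{k,k+1} = (z φ_k, φ_{k+1}^*)`. -/
lemma orthoPoly_schurBlock_left (hμ : ∀ s : Set Circle, s.Finite → μ sᶜ ≠ 0) (k : ℕ) (x : ℂ) :
    (orthoRevPoly μ k).eval x * schurBlock μ k 0 0 +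
      (orthoPoly μ (k + 1)).eval x * schurBlock μ k 1 0 = x * (orthoPoly μ k).eval x := by
  have h1 : (rho μ k : ℂ) ≠ 0 := by exact_mod_cast (rho_pos μ hμ k).ne'
  have h2 : (monicNorm μ k : ℂ) ≠ 0 := by exact_mod_cast (monicNorm_pos μ hμ k).ne'
  rw [orthoPoly_eq, orthoPoly_eq, orthoRevPoly, monicNorm_succ μ hμ, monicPoly_succ μ hμ]
  simp only [schurBlock, eval_mul, eval_C, eval_sub, eval_X, Matrix.of_apply, Matrix.cons_val',
    Matrix.cons_val_zero, Matrix.cons_val_one, Matrix.cons_val_fin_one]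
  push_cast
  field_simp
  ring

/-- The second column of `(φ_k^*, φ_{k+1}) G̃_{k,k+1} = (z φ_k, φ_{k+1}^*)`. -/
lemma orthoPoly_schurBlock_right (hμ : ∀ s : Set Circle, s.Finite → μ sᶜ ≠ 0) (k : ℕ) (x : ℂ) :
    (orthoRevPoly μ k).eval x * schurBlock μ k 0 1 +
      (orthoPoly μ (k + 1)).eval x * schurBlock μ k 1 1 = (orthoRevPoly μ (k + 1)).eval x := by
  have h1 : (rho μ k : ℂ) ≠ 0 := by exact_mod_cast (rho_pos μ hμ k).ne'
  have h2 : (monicNorm μ k : ℂ) ≠ 0 := by exact_mod_cast (monicNorm_pos μ hμ k).ne'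
  have h3 := rho_sq μ hμ k
  rw [orthoPoly_eq, orthoRevPoly, orthoRevPoly, monicNorm_succ μ hμ, monicPoly_succ μ hμ, revPoly]
  simp only [schurBlock, eval_mul, eval_C, eval_sub, eval_X, Matrix.of_apply, Matrix.cons_val',
    Matrix.cons_val_zero, Matrix.cons_val_one, Matrix.cons_val_fin_one]
  push_cast
  field_simp
  linear_combination (revPoly μ k).eval x * h3

end Recursion

/-! ### Para-orthogonal polynomials -/

section ParaOrthogonal

/-- The polynomial `z Φ_m - β Φ_m^*`: it equals `Φ_{m+1}` for `β = conj α_m`, and is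
para-orthogonal for `|β| = 1`. -/
def paraPoly (μ : Measure Circle) (m : ℕ) (β : ℂ) : ℂ[X] :=
  X * monicPoly μ m - C β * revPoly μ m

variable (μ : Measure Circle)

lemma paraPoly_monic (m : ℕ) (β : ℂ) : (paraPoly μ m β).Monic := by
  refine (monic_X.mul (monicPoly_monic μ m)).sub_of_left ?_
  rw [degree_X_mul_monicPoly]
  exact (degree_C_mul_le _ _).trans_lt (degree_revPoly_lt μ m)

lemma natDegree_paraPoly (m : ℕ) (β : ℂ) : (paraPoly μ m β).natDegree = m + 1 := by
  refine natDegree_eq_of_degree_eq_some ?_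
  rw [paraPoly, degree_sub_eq_left_of_degree_lt, degree_X_mul_monicPoly]
  rw [degree_X_mul_monicPoly]
  exact (degree_C_mul_le _ _).trans_lt (degree_revPoly_lt μ m)

lemma paraPoly_eval_zero (m : ℕ) (β : ℂ) : (paraPoly μ m β).eval 0 = -β := by
  simp [paraPoly, revPoly_eval_zero]

/-- If `z Φ_m - β Φ_m^* = (z - w) ^ 2 R` with `|w| = 1`, then orthogonality to `z R` gives
`∫ |z - w| ^ 2 |R| ^ 2 dμ = 0`, because `conj z (z - w) ^ 2 = -w |z - w| ^ 2` on the circle. -/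
lemma not_sq_dvd_paraPoly [IsFiniteMeasure μ] (hμ : ∀ s : Set Circle, s.Finite → μ sᶜ ≠ 0)
    (m : ℕ) (β : ℂ) (w : Circle) : ¬ (X - C (w : ℂ)) ^ 2 ∣ paraPoly μ m β := by
  rintro ⟨R, hR⟩
  have hne : paraPoly μ m β ≠ 0 := (paraPoly_monic μ m β).ne_zero
  have hR0 : R ≠ 0 := by
    rintro rfl
    exact hne (by rw [hR, mul_zero])
  have hdeg : R.degree < m := by
    have h := natDegree_paraPoly μ m β
    rw [hR, natDegree_mul (pow_ne_zero 2 (X_sub_C_ne_zero _)) hR0, natDegree_pow,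
      natDegree_X_sub_C] at h
    rw [degree_eq_natDegree hR0]
    exact_mod_cast (by omega : R.natDegree < m)
  have horth : ip μ (X * R) (paraPoly μ m β) = 0 := by
    rw [paraPoly, ip_sub_right, ip_C_mul_right, ip_X_mul_X_mul, ip_monicPoly_of_degree_lt hμ hdeg,
      ip_X_mul_revPoly μ hμ (revPoly_eval_circle μ hμ m) hdeg]
    ring
  have hself : ip μ (X * R) (paraPoly μ m β) =
      ip μ ((X - C (w : ℂ)) * R) (C (-(w : ℂ)) * ((X - C (w : ℂ)) * R)) := by
    rw [hR]
    unfold ip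
    congr 1
    ext z
    have hz := circle_conj_mul z
    have hw := circle_conj_mul w
    simp only [map_mul, eval_mul, eval_X, eval_sub, eval_C, eval_pow, map_sub]
    linear_combination ((starRingEnd ℂ) (R.eval (z : ℂ)) * R.eval (z : ℂ)) *
      ((z : ℂ) - w) * (hz - hw)
  rw [horth, ip_C_mul_right] at hself
  have hw0 : (w : ℂ) ≠ 0 := Circle.coe_ne_zero w
  have h0 := (mul_eq_zero.1 hself.symm).resolve_left (neg_ne_zero.2 hw0)
  exact mul_ne_zero (X_sub_C_ne_zero _) hR0 (eq_zero_of_ip_self hμ h0)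

end ParaOrthogonal

/-! ### Principal submatrices of snake-shaped products -/

section Snake

lemma principal_infMul {A B : Matrix ℕ ℕ ℂ} {n : ℕ}
    (h : ∀ i < n, ∀ j < n, ∀ m, n ≤ m → A i m * B m j = 0) :
    principal (infMul A B) n = principal A n * principal B n := by
  ext i j
  rw [Matrix.mul_apply]
  simp only [principal, Matrix.submatrix_apply, infMul]
  rw [tsum_eq_sum (s := Finset.range n), Finset.sum_range]
  intro m hm
  exact h i i.2 j j.2 m (by simpa using hm)

lemma givens_apply_of_ne {k i j : ℕ} (M : Matrix (Fin 2) (Fin 2) ℂ) (h : k + 1 < i ∨ k + 1 < j)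
    (hij : i ≠ j) : givens k M i j = 0 := by
  unfold givens
  split_ifs <;> first | omega | rfl

/-- The `k`-th iterate agrees with the identity outside the rows and columns `0, …, k + 1`. -/
lemma partialSnake_apply_of_ne (p : ℕ → ℕ) (g : ℕ → Matrix (Fin 2) (Fin 2) ℂ) {k i j : ℕ}
    (h : k + 1 < i ∨ k + 1 < j) (hij : i ≠ j) : partialSnake p g k i j = 0 := by
  induction k generalizing i j with
  | zero => exact givens_apply_of_ne _ h hij
  | succ k ih =>
    rw [partialSnake]
    split_ifs
    all_goals
      unfold infMul
      refine (tsum_congr fun m => ?_).trans tsum_zero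
      by_cases h1 : i = m
      · subst h1
        first
          | rw [givens_apply_of_ne _ h hij, mul_zero]
          | rw [ih (by omega) hij, mul_zero]
      · by_cases h2 : m = j
        · subst h2
          first
            | rw [givens_apply_of_ne _ h hij, zero_mul]
            | rw [ih (by omega) hij, zero_mul]
        · rcases h with h | h
          · first
              | rw [givens_apply_of_ne _ (Or.inl h) h1, zero_mul]
              | rw [ih (by omega) h1, zero_mul]
          · first
              | rw [givens_apply_of_ne _ (Or.inr h) h2, mul_zero]
              | rw [ih (by omega) h2, mul_zero]

lemma principal_partialSnake_succ (p : ℕ → ℕ) (g : ℕ → Matrix (Fin 2) (Fin 2) ℂ) {k n : ℕ}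
    (hk : k + 1 < n) : principal (partialSnake p g (k + 1)) n =
      if p (k + 1) = p k then
        principal (partialSnake p g k) n * principal (givens (k + 1) (g (k + 1))) n
      else principal (givens (k + 1) (g (k + 1))) n * principal (partialSnake p g k) n := by
  rw [partialSnake]
  split_ifs
  · refine principal_infMul fun i hi j _ m hm => ?_
    rw [partialSnake_apply_of_ne p g (by omega) (by omega), zero_mul]
  · refine principal_infMul fun i _ j hj m hm => ?_
    rw [partialSnake_apply_of_ne p g (by omega) (by omega), mul_zero]

lemma principal_snake (p : ℕ → ℕ) (g : ℕ → Matrix (Fin 2) (Fin 2) ℂ) (m : ℕ) :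
    principal (snake p g) (m + 1) = principal (partialSnake p g m) (m + 1) := by
  ext i j
  exact (partialSnake_eventually p g (Nat.lt_succ_iff.1 i.2) (Nat.lt_succ_iff.1 j.2)).symm

lemma partialSnake_congr (p : ℕ → ℕ) {g g' : ℕ → Matrix (Fin 2) (Fin 2) ℂ} {k : ℕ}
    (h : ∀ i ≤ k, g i = g' i) : partialSnake p g k = partialSnake p g' k := by
  induction k with
  | zero => rw [partialSnake, partialSnake, h 0 le_rfl]
  | succ k ih =>
    rw [partialSnake, partialSnake, h (k + 1) le_rfl, ih fun i hi => h i (hi.trans k.le_succ)]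

/-- The action of a Givens transformation on row vectors. When `k + 1 = n` the block is cut off
after its first row and column, and the formula needs the vector to vanish at `n`. -/
lemma vecMul_givens (y : ℕ → ℂ) (M : Matrix (Fin 2) (Fin 2) ℂ) {k n : ℕ} (hk : k < n)
    (hy : k + 1 = n → y (k + 1) = 0) :
    Matrix.vecMul (fun i : Fin n => y i) (principal (givens k M) n) = fun i : Fin n =>
      if (i : ℕ) = k then y k * M 0 0 + y (k + 1) * M 1 0
      else if (i : ℕ) = k + 1 then y k * M 0 1 + y (k + 1) * M 1 1 else y i := by
  funext i
  have hi := i.2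
  have h1 : Matrix.vecMul (fun i : Fin n => y i) (principal (givens k M) n) i =
      ∑ j ∈ Finset.range n, y j * givens k M j i :=
    (Finset.sum_range fun j => y j * givens k M j i).symm
  have h2 : ∑ j ∈ Finset.range n, y j * givens k M j i =
      ∑ j ∈ Finset.range (n + 1), y j * givens k M j i := by
    rw [Finset.sum_range_succ]
    rcases (Nat.succ_le_of_lt hk).eq_or_lt with h | h
    · have : y n = 0 := by rw [← h]; exact hy h
      rw [this, zero_mul, add_zero]
    · rw [givens_apply_of_ne M (Or.inl h) hi.ne', mul_zero, add_zero]
  have hk1 : k ∈ Finset.range (n + 1) := by rw [Finset.mem_range]; omega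
  have hk2 : k + 1 ∈ Finset.range (n + 1) := by rw [Finset.mem_range]; omega
  have hi1 : (i : ℕ) ∈ Finset.range (n + 1) := by rw [Finset.mem_range]; omega
  rw [h1, h2]
  split_ifs with ha hb
  · rw [ha, ← Finset.sum_subset (s₁ := {k, k + 1}), Finset.sum_pair (by omega)]
    · simp [givens]
    · simp [Finset.insert_subset_iff, hk, hk.le]
    · intro j _ hj
      have : givens k M j k = 0 := by
        simp only [Finset.mem_insert, Finset.mem_singleton, not_or] at hj
        unfold givens
        split_ifs <;> first | omega | rfl
      rw [this, mul_zero]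
  · rw [hb, ← Finset.sum_subset (s₁ := {k, k + 1}), Finset.sum_pair (by omega)]
    · simp [givens]
    · simp [Finset.insert_subset_iff, hk, hk.le]
    · intro j _ hj
      have : givens k M j (k + 1) = 0 := by
        simp only [Finset.mem_insert, Finset.mem_singleton, not_or] at hj
        unfold givens
        split_ifs <;> first | omega | rfl
      rw [this, mul_zero]
  · rw [Finset.sum_eq_single_of_mem _ hi1]
    · simp [givens, ha, hb]
    · intro j _ hj
      have : givens k M j i = 0 := by
        unfold givens
        split_ifs <;> first | omega | rfl
      rw [this, mul_zero]

lemma principal_givens_last (M : Matrix (Fin 2) (Fin 2) ℂ) (m : ℕ) :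
    principal (givens m M) (m + 1) =
      Matrix.diagonal fun i => if i = Fin.last m then M 0 0 else 1 := by
  ext i j
  have hi := i.2
  have hj := j.2
  rw [Matrix.diagonal_apply]
  simp only [principal, Matrix.submatrix_apply, givens, Fin.ext_iff, Fin.val_last]
  split_ifs <;> first | omega | rfl

/-! ### Row eigenvectors of the snake -/

/-- Given sequences `a`, `b` (below `φ_k(x)` and `φ_k^*(x)`), the row vector with components
`x ^ (-p_i) a_i` if `s_i = 0` and `x ^ (-p_i) b_i` if `s_i = 1`. (For `i = 0` the test
`p i = p (i - 1)` is vacuously true.) -/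
def snakeRow (p : ℕ → ℕ) (a b : ℕ → ℂ) (x : ℂ) (i : ℕ) : ℂ :=
  (x ^ p i)⁻¹ * if p i = p (i - 1) then a i else b i

variable {p : ℕ → ℕ} {g : ℕ → Matrix (Fin 2) (Fin 2) ℂ} {a b : ℕ → ℂ} {x : ℂ} {n : ℕ}

/-- If `(b_k, a_{k+1}) g_k = (x a_k, b_{k+1})` for all `k`, then the `k`-th iterate multiplies the
components `0, …, k` of the row vector by `x`, and turns its component `k + 1`, as long as that
has the value `x ^ (-p_k) a_{k+1}`, into `x ^ (-p_k) b_{k+1}`. -/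
lemma vecMul_partialSnake (hp : IsGeneratingSequence p) (hx : x ≠ 0) (h0 : a 0 = b 0)
    (h1 : ∀ k < n, b k * g k 0 0 + a (k + 1) * g k 1 0 = x * a k)
    (h2 : ∀ k < n, b k * g k 0 1 + a (k + 1) * g k 1 1 = b (k + 1)) (hn : a n = 0) {k : ℕ}
    (hk : k < n) (y : ℕ → ℂ) (hy : ∀ i ≤ k, y i = snakeRow p a b x i)
    (hy' : y (k + 1) = (x ^ p k)⁻¹ * a (k + 1)) :
    Matrix.vecMul (fun i : Fin n => y i) (principal (partialSnake p g k) n) = fun i : Fin n =>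
      if (i : ℕ) ≤ k then x * snakeRow p a b x i
      else if (i : ℕ) = k + 1 then (x ^ p k)⁻¹ * b (k + 1) else y i := by
  induction k generalizing y with
  | zero =>
    rw [partialSnake, vecMul_givens y (g 0) hk fun h => by rw [hy', h, hn, mul_zero]]
    funext i
    simp only [hy 0 le_rfl, hy', snakeRow, Nat.zero_sub, if_true, Nat.le_zero]
    split_ifs with h h' h''
    · rw [h]
      linear_combination (x ^ p 0)⁻¹ * (h1 0 hk + g 0 0 0 * h0)
    · exact absurd h' (by rw [h]; exact fun h => h rfl)
    · linear_combination (x ^ p 0)⁻¹ * (h2 0 hk + g 0 0 1 * h0)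
    · rfl
  | succ k ih =>
    have hrow : ∀ i ≤ k, y i = snakeRow p a b x i := fun i hi => hy i (hi.trans k.le_succ)
    have hlast : k + 1 + 1 = n → y (k + 1 + 1) = 0 := fun h => by rw [hy', h, hn, mul_zero]
    rw [principal_partialSnake_succ p g hk]
    split_ifs with hs
    · have hyk : y (k + 1) = (x ^ p (k + 1))⁻¹ * a (k + 1) := by
        rw [hy _ le_rfl, snakeRow, Nat.add_sub_cancel, if_pos hs]
      rw [← Matrix.vecMul_vecMul, ih (k.lt_succ_self.trans hk) y hrow (hs ▸ hyk)]
      have := vecMul_givens (n := n) (fun i => if i ≤ k then x * snakeRow p a b x i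
        else if i = k + 1 then (x ^ p k)⁻¹ * b (k + 1) else y i) (g (k + 1)) hk (fun h => by
          rw [if_neg (by omega), if_neg (by omega)]
          exact hlast h)
      rw [this]
      funext i
      simp only [show ¬ k + 1 ≤ k by omega, show ¬ k + 1 + 1 ≤ k by omega,
        show ¬ k + 1 + 1 = k + 1 by omega, if_true, if_false, hy', ← hs]
      split_ifs with c1 c2 c3 c4 c5 c6 <;> try omega
      · rw [c1, ← hy _ le_rfl, hyk]
        linear_combination (x ^ p (k + 1))⁻¹ * h1 (k + 1) hk
      · linear_combination (x ^ p (k + 1))⁻¹ * h2 (k + 1) hk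
      · rfl
      · rfl
    · have hs' : p (k + 1) = p k + 1 := (hp.step k).resolve_left hs
      have hpow : (x ^ p k)⁻¹ = x * (x ^ p (k + 1))⁻¹ := by
        rw [hs', pow_succ]
        field_simp
      have hyk : y (k + 1) = (x ^ p (k + 1))⁻¹ * b (k + 1) := by
        rw [hy _ le_rfl, snakeRow, Nat.add_sub_cancel, if_neg hs]
      rw [← Matrix.vecMul_vecMul, vecMul_givens y (g (k + 1)) hk hlast]
      have := ih (k.lt_succ_self.trans hk)
        (fun i => if i = k + 1 then y (k + 1) * g (k + 1) 0 0 + y (k + 1 + 1) * g (k + 1) 1 0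
          else if i = k + 1 + 1 then y (k + 1) * g (k + 1) 0 1 + y (k + 1 + 1) * g (k + 1) 1 1
          else y i) (fun i hi => by
            rw [if_neg (by omega), if_neg (by omega)]
            exact hrow i hi) (by
            rw [if_pos rfl, hyk, hy', hpow]
            linear_combination (x ^ p (k + 1))⁻¹ * h1 (k + 1) hk)
      rw [this]
      funext i
      split_ifs with c1 c2 c3 c4 c5 <;> try omega
      · rfl
      · have hik : (i : ℕ) = k + 1 := by omega
        rw [hik, ← hy _ le_rfl, hyk, hpow]
        ring
      · rw [hyk, hy']
        linear_combination (x ^ p (k + 1))⁻¹ * h2 (k + 1) hk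
      · rfl

lemma vecMul_principal_snake {m : ℕ} (hp : IsGeneratingSequence p) (hx : x ≠ 0) (h0 : a 0 = b 0)
    (h1 : ∀ k < m + 1, b k * g k 0 0 + a (k + 1) * g k 1 0 = x * a k)
    (h2 : ∀ k < m + 1, b k * g k 0 1 + a (k + 1) * g k 1 1 = b (k + 1)) (hn : a (m + 1) = 0) :
    Matrix.vecMul (fun i : Fin (m + 1) => snakeRow p a b x i) (principal (snake p g) (m + 1)) =
      fun i : Fin (m + 1) => x * snakeRow p a b x i := by
  have h := vecMul_partialSnake hp hx h0 h1 h2 hn m.lt_succ_self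
    (fun i => if i ≤ m then snakeRow p a b x i else 0) (fun i hi => if_pos hi)
    (by rw [if_neg (by omega), hn, mul_zero])
  have hle (i : Fin (m + 1)) : (i : ℕ) ≤ m := Nat.lt_succ_iff.1 i.2
  simp only [hle, if_true] at h
  rw [principal_snake, h]

end Snake

/-- The row vector of the snake of shape `p` that is attached to the orthonormal Szegő
polynomials and their reversals, evaluated at `x`. -/
def szegoRow (μ : Measure Circle) (p : ℕ → ℕ) (x : ℂ) (i : ℕ) : ℂ :=
  snakeRow p (fun k => (orthoPoly μ k).eval x) (fun k => (orthoRevPoly μ k).eval x) x i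

section SzegoRow

variable (μ : Measure Circle)

/-- At a zero of `z Φ_m - β Φ_m^*` the recursion `(φ_k^*, φ_{k+1}) G_k = (x φ_k, φ_{k+1}^*)`
persists for `k = m` if the last block has upper left entry `β` and `φ_{m+1}(x)` is replaced
by `0`. -/
lemma vecMul_szegoRow [IsFiniteMeasure μ] (hμ : ∀ s : Set Circle, s.Finite → μ sᶜ ≠ 0)
    {p : ℕ → ℕ} (hp : IsGeneratingSequence p) {m : ℕ} {M : Matrix (Fin 2) (Fin 2) ℂ} {x β : ℂ}
    (hx : x ≠ 0) (hM : M 0 0 = β) (hroot : (paraPoly μ m β).IsRoot x) :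
    Matrix.vecMul (fun i : Fin (m + 1) => szegoRow μ p x i)
      (principal (snake p (Function.update (schurBlock μ) m M)) (m + 1)) =
      fun i : Fin (m + 1) => x * szegoRow μ p x i := by
  subst hM
  have key := vecMul_principal_snake (p := p) (g := Function.update (schurBlock μ) m M)
    (a := fun k => if k ≤ m then (orthoPoly μ k).eval x else 0)
    (b := fun k => if k ≤ m then (orthoRevPoly μ k).eval x else (orthoRevPoly μ m).eval x * M 0 1)
    (x := x) (m := m) hp hx ?_ ?_ ?_ ?_
  · have hrow (i : Fin (m + 1)) : snakeRow p
        (fun k => if k ≤ m then (orthoPoly μ k).eval x else 0)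
        (fun k => if k ≤ m then (orthoRevPoly μ k).eval x
          else (orthoRevPoly μ m).eval x * M 0 1) x i = szegoRow μ p x i := by
      simp only [szegoRow, snakeRow, Nat.lt_succ_iff.1 i.2, if_true]
    simpa only [hrow] using key
  · simp [orthoPoly_eq, orthoRevPoly, monicPoly_zero, revPoly]
  · intro k hk
    rcases (Nat.lt_succ_iff.1 hk).eq_or_lt with rfl | hk
    · have h := hroot
      rw [IsRoot.def, paraPoly] at h
      simp only [eval_sub, eval_mul, eval_X, eval_C] at h
      simp only [le_refl, if_true, Function.update_self, show ¬ k + 1 ≤ k by omega, if_false,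
        orthoPoly_eq, orthoRevPoly, eval_mul, eval_C]
      linear_combination -(((monicNorm μ k)⁻¹ : ℝ) : ℂ) * h
    · simp only [hk.le, show k + 1 ≤ m from hk, if_true, Function.update_of_ne hk.ne]
      exact orthoPoly_schurBlock_left μ hμ k x
  · intro k hk
    rcases (Nat.lt_succ_iff.1 hk).eq_or_lt with rfl | hk
    · simp
    · simp only [hk.le, show k + 1 ≤ m from hk, if_true, Function.update_of_ne hk.ne]
      exact orthoPoly_schurBlock_right μ hμ k x
  · simp

lemma szegoRow_zero [IsProbabilityMeasure μ] {p : ℕ → ℕ} (hp : IsGeneratingSequence p) (x : ℂ) :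
    szegoRow μ p x 0 = 1 := by
  simp [szegoRow, snakeRow, hp.zero, orthoPoly_eq, monicNorm, monicPoly_zero]

lemma norm_szegoRow [IsFiniteMeasure μ] (hμ : ∀ s : Set Circle, s.Finite → μ sᶜ ≠ 0)
    (p : ℕ → ℕ) (z : Circle) (i : ℕ) :
    ‖szegoRow μ p z i‖ = ‖(orthoPoly μ i).eval (z : ℂ)‖ := by
  have hz : ‖(z : ℂ)‖ = 1 := Circle.norm_coe z
  rw [szegoRow, snakeRow, norm_mul, norm_inv, norm_pow, hz, one_pow, inv_one, one_mul]
  split_ifs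
  · rfl
  · exact norm_orthoRevPoly_eval_circle μ hμ i z

end SzegoRow

/-! ### Unitarity -/

section Unitary

lemma conjTranspose_principal_givens (k n : ℕ) (M : Matrix (Fin 2) (Fin 2) ℂ) :
    (principal (givens k M) n).conjTranspose = principal (givens k M.conjTranspose) n := by
  ext i j
  simp only [principal, givens, Matrix.conjTranspose_apply, Matrix.submatrix_apply]
  split_ifs <;> first | omega | simp

lemma principal_givens_mem_unitaryGroup {k n : ℕ} (hk : k < n) {M : Matrix (Fin 2) (Fin 2) ℂ}
    (hM : M ∈ Matrix.unitaryGroup (Fin 2) ℂ) (h : k + 1 = n → M 0 1 = 0) :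
    principal (givens k M) n ∈ Matrix.unitaryGroup (Fin n) ℂ := by
  rw [Matrix.mem_unitaryGroup_iff, Matrix.star_eq_conjTranspose, conjTranspose_principal_givens]
  rw [Matrix.mem_unitaryGroup_iff, Matrix.star_eq_conjTranspose] at hM
  have hM' (i j : Fin 2) : M i 0 * M.conjTranspose 0 j + M i 1 * M.conjTranspose 1 j =
      (1 : Matrix (Fin 2) (Fin 2) ℂ) i j := by
    rw [← hM, Matrix.mul_apply, Fin.sum_univ_two]
  have h00 := hM' 0 0
  have h01 := hM' 0 1
  have h10 := hM' 1 0
  have h11 := hM' 1 1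
  simp only [Matrix.one_apply_eq, Matrix.one_apply_ne zero_ne_one,
    Matrix.one_apply_ne (one_ne_zero : (1 : Fin 2) ≠ 0)] at h00 h01 h10 h11
  -- Compare the actions on a row vector, extended by zero.
  refine Matrix.ext_iff_vecMul.2 fun v => ?_
  obtain ⟨y, hy, hyn⟩ : ∃ y : ℕ → ℂ, (v = fun i : Fin n => y i) ∧ y n = 0 := by
    refine ⟨fun i => if h : i < n then v ⟨i, h⟩ else 0, ?_, by simp⟩
    funext i
    simp
  have hlast : k + 1 = n → y (k + 1) = 0 := fun h => by rw [h, hyn]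
  rw [← Matrix.vecMul_vecMul, Matrix.vecMul_one, hy, vecMul_givens y M hk hlast]
  have := vecMul_givens (n := n) (fun i => if i = k then y k * M 0 0 + y (k + 1) * M 1 0
    else if i = k + 1 then y k * M 0 1 + y (k + 1) * M 1 1 else y i) M.conjTranspose hk
    (fun hn => by
      rw [if_neg (by omega), if_pos rfl, h hn, hlast hn]
      ring)
  rw [this]
  funext i
  simp only [if_true, show ¬ k + 1 = k by omega, if_false]
  split_ifs with c1 c2
  · rw [c1]
    linear_combination y k * h00 + y (k + 1) * h10
  · rw [c2]
    linear_combination y k * h01 + y (k + 1) * h11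
  · rfl

open scoped ComplexOrder in
lemma norm_eq_one_of_vecMul_eq {ι : Type*} [Fintype ι] [DecidableEq ι] {U : Matrix ι ι ℂ}
    (hU : U ∈ Matrix.unitaryGroup ι ℂ) {x : ι → ℂ} (hx0 : x ≠ 0) {z : ℂ}
    (hx : Matrix.vecMul x U = fun i => z * x i) : ‖z‖ = 1 := by
  rw [Matrix.mem_unitaryGroup_iff, Matrix.star_eq_conjTranspose] at hU
  have hx' : Matrix.vecMul x U = z • x := hx
  have h : Matrix.vecMul x U ⬝ᵥ star (Matrix.vecMul x U) = x ⬝ᵥ star x := by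
    rw [Matrix.star_vecMul, Matrix.dotProduct_mulVec, Matrix.vecMul_vecMul, hU, Matrix.vecMul_one]
  rw [hx', star_smul, smul_dotProduct, dotProduct_smul, smul_smul, smul_eq_mul] at h
  have h1 : z * star z = 1 := by
    refine mul_right_cancel₀ (mt dotProduct_star_self_eq_zero.1 hx0) ?_
    rw [dotProduct_comm (star x), h, one_mul]
  have h2 : ‖z‖ * ‖z‖ = 1 := by simpa using congrArg norm h1
  nlinarith [norm_nonneg z]

/-- The conjugate of a row eigenvector of a unitary matrix is a column eigenvector. -/
lemma mulVec_star_of_vecMul_eq {ι : Type*} [Fintype ι] [DecidableEq ι] {U : Matrix ι ι ℂ}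
    (hU : U ∈ Matrix.unitaryGroup ι ℂ) {x : ι → ℂ} {z : ℂ} (hz : ‖z‖ = 1)
    (hx : Matrix.vecMul x U = fun i => z * x i) : U.mulVec (star x) = z • star x := by
  rw [Matrix.mem_unitaryGroup_iff, Matrix.star_eq_conjTranspose] at hU
  have hx' : Matrix.vecMul x U = z • x := hx
  have h := congrArg (fun y => U.mulVec (star y)) hx'
  simp only [Matrix.star_vecMul, Matrix.mulVec_mulVec, hU, Matrix.one_mulVec, star_smul,
    Matrix.mulVec_smul] at h
  have h1 : z * star z = 1 := by
    have := RCLike.mul_conj z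
    rw [hz] at this
    simpa using this
  nth_rewrite 2 [h]
  rw [smul_smul, h1, one_smul]

/-- Eigenvectors of a unitary matrix for different eigenvalues are orthogonal. -/
lemma star_dotProduct_eq_zero {ι : Type*} [Fintype ι] [DecidableEq ι] {U : Matrix ι ι ℂ}
    (hU : U ∈ Matrix.unitaryGroup ι ℂ) {v w : ι → ℂ} {a b : Circle} (hab : a ≠ b)
    (hv : U.mulVec v = (a : ℂ) • v) (hw : U.mulVec w = (b : ℂ) • w) : star v ⬝ᵥ w = 0 := by
  rw [Matrix.mem_unitaryGroup_iff', Matrix.star_eq_conjTranspose] at hU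
  have h : star (U.mulVec v) ⬝ᵥ U.mulVec w = star v ⬝ᵥ w := by
    rw [Matrix.star_mulVec, ← Matrix.dotProduct_mulVec, Matrix.mulVec_mulVec, hU,
      Matrix.one_mulVec]
  rw [hv, hw, star_smul, smul_dotProduct, dotProduct_smul, smul_smul, smul_eq_mul] at h
  by_contra h0
  have h1 : star (a : ℂ) * b = 1 := by
    refine mul_right_cancel₀ h0 ?_
    rw [h, one_mul]
  have h2 : (a : ℂ) * star (a : ℂ) = 1 := (mul_comm _ _).trans (circle_conj_mul a)
  exact hab (Circle.coe_injective (by linear_combination (b : ℂ) * h2 - (a : ℂ) * h1))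

lemma schurBlock_mem_unitaryGroup (μ : Measure Circle) [IsFiniteMeasure μ]
    (hμ : ∀ s : Set Circle, s.Finite → μ sᶜ ≠ 0) (k : ℕ) :
    schurBlock μ k ∈ Matrix.unitaryGroup (Fin 2) ℂ := by
  have h := rho_sq μ hμ k
  rw [Matrix.mem_unitaryGroup_iff, Matrix.star_eq_conjTranspose]
  ext i j
  fin_cases i <;> fin_cases j <;>
    simp [schurBlock, Matrix.mul_apply, Fin.sum_univ_two] <;>
    first
      | linear_combination h
      | ring

lemma principal_snake_mem_unitaryGroup (p : ℕ → ℕ) {g : ℕ → Matrix (Fin 2) (Fin 2) ℂ} {m : ℕ}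
    (hg : ∀ k ≤ m, g k ∈ Matrix.unitaryGroup (Fin 2) ℂ) (hm : g m 0 1 = 0) :
    principal (snake p g) (m + 1) ∈ Matrix.unitaryGroup (Fin (m + 1)) ℂ := by
  rw [principal_snake]
  have hG (k : ℕ) (hk : k ≤ m) :
      principal (givens k (g k)) (m + 1) ∈ Matrix.unitaryGroup (Fin (m + 1)) ℂ :=
    principal_givens_mem_unitaryGroup (Nat.lt_succ_of_le hk) (hg k hk) fun h => by
      rw [Nat.succ_injective h, hm]
  have : ∀ k ≤ m, principal (partialSnake p g k) (m + 1) ∈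
      Matrix.unitaryGroup (Fin (m + 1)) ℂ := by
    intro k
    induction k with
    | zero => exact hG 0
    | succ k ih =>
      intro hk
      rw [principal_partialSnake_succ p g (Nat.lt_succ_of_le hk)]
      split_ifs
      · exact mul_mem (ih (by omega)) (hG _ hk)
      · exact mul_mem (hG _ hk) (ih (by omega))
  exact this m le_rfl

end Unitary

/-! ### The characteristic polynomial -/

section Charpoly

/-- All factors but the last one can be collected on one side, by cyclic invariance of the
characteristic polynomial. -/
lemma exists_charpoly_principal_snake_eq (p : ℕ → ℕ) (g : ℕ → Matrix (Fin 2) (Fin 2) ℂ) (m : ℕ) :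
    ∃ W : Matrix (Fin (m + 1)) (Fin (m + 1)) ℂ, ∀ M : Matrix (Fin 2) (Fin 2) ℂ,
      (principal (snake p (Function.update g m M)) (m + 1)).charpoly =
        (W * Matrix.diagonal fun i => if i = Fin.last m then M 0 0 else 1).charpoly := by
  rcases m with _ | m
  · refine ⟨1, fun M => ?_⟩
    rw [principal_snake, partialSnake, Function.update_self, principal_givens_last, one_mul]
  · refine ⟨principal (partialSnake p g m) (m + 1 + 1), fun M => ?_⟩
    rw [principal_snake, principal_partialSnake_succ p _ (Nat.lt_succ_self _),
      Function.update_self, principal_givens_last,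
      partialSnake_congr p (g' := g) fun i hi => Function.update_of_ne (by omega) _ _]
    split_ifs
    · rfl
    · rw [Matrix.charpoly_mul_comm]

/-- The characteristic polynomial of `W * diag (1, …, 1, β)` is affine in `β`, as only the last
column depends on `β`. -/
lemma exists_charpoly_mul_diagonal_eq {m : ℕ} (W : Matrix (Fin (m + 1)) (Fin (m + 1)) ℂ) :
    ∃ A B : ℂ[X], ∀ β : ℂ, (W * Matrix.diagonal fun i => if i = Fin.last m then β else 1).charpoly =
      A + C β * B := by
  set u : Fin (m + 1) → ℂ[X] := fun i => if i = Fin.last m then X else 0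
  set v : Fin (m + 1) → ℂ[X] := fun i => -C (W i (Fin.last m))
  refine ⟨(W.charmatrix.updateCol (Fin.last m) u).det, (W.charmatrix.updateCol (Fin.last m) v).det,
    fun β => ?_⟩
  rw [← Matrix.det_updateCol_smul, ← Matrix.det_updateCol_add, Matrix.charpoly]
  congr 1
  ext1 i j
  rw [Matrix.updateCol_apply, Matrix.charmatrix_apply, Matrix.mul_diagonal]
  split_ifs with h
  · subst h
    simp only [Matrix.diagonal_apply, u, v, Pi.add_apply, Pi.smul_apply, smul_eq_mul, C_mul]
    ring
  · rw [Matrix.charmatrix_apply, mul_one]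

lemma diag_mem_unitaryGroup {β β' : ℂ} (hβ : ‖β‖ = 1) (hβ' : ‖β'‖ = 1) :
    !![β, 0; 0, β'] ∈ Matrix.unitaryGroup (Fin 2) ℂ := by
  have h {c : ℂ} (hc : ‖c‖ = 1) : c * (starRingEnd ℂ) c = 1 := by
    rw [RCLike.mul_conj, hc]
    simp
  rw [Matrix.mem_unitaryGroup_iff, Matrix.star_eq_conjTranspose]
  ext i j
  fin_cases i <;> fin_cases j <;> simp [Matrix.mul_apply, Fin.sum_univ_two, h hβ, h hβ']

variable (μ : Measure Circle)

lemma ne_zero_of_isRoot_paraPoly {m : ℕ} {β : ℂ} (hβ : ‖β‖ = 1) {x : ℂ}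
    (hx : (paraPoly μ m β).IsRoot x) : x ≠ 0 := by
  rintro rfl
  rw [IsRoot.def, paraPoly_eval_zero, neg_eq_zero] at hx
  simp [hx] at hβ

lemma card_roots_paraPoly (m : ℕ) (β : ℂ) : (paraPoly μ m β).roots.card = m + 1 := by
  rw [← natDegree_paraPoly μ m β]
  exact (IsAlgClosed.splits _).natDegree_eq_card_roots.symm

variable [IsProbabilityMeasure μ]

lemma principal_update_mem_unitaryGroup (hμ : ∀ s : Set Circle, s.Finite → μ sᶜ ≠ 0)
    (p : ℕ → ℕ) (m : ℕ) {β β' : ℂ} (hβ : ‖β‖ = 1) (hβ' : ‖β'‖ = 1) :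
    principal (snake p (Function.update (schurBlock μ) m !![β, 0; 0, β'])) (m + 1) ∈
      Matrix.unitaryGroup (Fin (m + 1)) ℂ := by
  refine principal_snake_mem_unitaryGroup p (fun k hk => ?_) (by simp)
  rcases hk.eq_or_lt with rfl | hk
  · rw [Function.update_self]
    exact diag_mem_unitaryGroup hβ hβ'
  · rw [Function.update_of_ne hk.ne]
    exact schurBlock_mem_unitaryGroup μ hμ k

lemma szegoRow_ne_zero {p : ℕ → ℕ} (hp : IsGeneratingSequence p) (m : ℕ) (x : ℂ) :
    (fun i : Fin (m + 1) => szegoRow μ p x i) ≠ 0 := fun h => by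
  have := congrFun h 0
  rw [Fin.val_zero, szegoRow_zero μ hp] at this
  exact one_ne_zero this

/-- If `|β| = 1` then the truncation is unitary and every zero of `z Φ_m - β Φ_m^*` is an
eigenvalue, with the row eigenvector `szegoRow`; so the zeros lie on the circle. -/
lemma norm_eq_one_of_isRoot_paraPoly (hμ : ∀ s : Set Circle, s.Finite → μ sᶜ ≠ 0) {m : ℕ} {β : ℂ}
    (hβ : ‖β‖ = 1) {x : ℂ} (hx : (paraPoly μ m β).IsRoot x) : ‖x‖ = 1 := by
  have hp : IsGeneratingSequence fun _ => 0 := ⟨rfl, fun n => n.zero_le, fun _ => Or.inl rfl⟩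
  exact norm_eq_one_of_vecMul_eq
    (principal_update_mem_unitaryGroup μ hμ (fun _ => 0) m hβ norm_one)
    (szegoRow_ne_zero μ hp m x)
    (vecMul_szegoRow μ hμ hp (ne_zero_of_isRoot_paraPoly μ hβ hx) rfl hx)

lemma nodup_roots_paraPoly (hμ : ∀ s : Set Circle, s.Finite → μ sᶜ ≠ 0) {m : ℕ} {β : ℂ}
    (hβ : ‖β‖ = 1) : (paraPoly μ m β).roots.Nodup := by
  rw [Multiset.nodup_iff_count_le_one]
  intro x
  rw [count_roots]
  by_contra! h
  have hne := (paraPoly_monic μ m β).ne_zero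
  have hx : (paraPoly μ m β).IsRoot x := (rootMultiplicity_pos hne).1 (by omega)
  have hx1 := norm_eq_one_of_isRoot_paraPoly μ hμ hβ hx
  exact not_sq_dvd_paraPoly μ hμ m β ⟨x, mem_sphere_zero_iff_norm.2 hx1⟩
    ((le_rootMultiplicity_iff hne).1 h)

lemma charpoly_principal_snake_of_norm_eq_one (hμ : ∀ s : Set Circle, s.Finite → μ sᶜ ≠ 0)
    {p : ℕ → ℕ} (hp : IsGeneratingSequence p) (m : ℕ) {β : ℂ} (hβ : ‖β‖ = 1) (β' : ℂ) :
    (principal (snake p (Function.update (schurBlock μ) m !![β, 0; 0, β'])) (m + 1)).charpoly =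
      paraPoly μ m β := by
  set U := principal (snake p (Function.update (schurBlock μ) m !![β, 0; 0, β'])) (m + 1)
  have hroot (x : ℂ) (hx : (paraPoly μ m β).IsRoot x) : U.charpoly.IsRoot x := by
    rw [IsRoot.def, Matrix.eval_charpoly, ← Matrix.exists_vecMul_eq_zero_iff]
    refine ⟨_, szegoRow_ne_zero μ hp m x, ?_⟩
    rw [Matrix.vecMul_sub,
      vecMul_szegoRow μ hμ hp (M := !![β, 0; 0, β']) (ne_zero_of_isRoot_paraPoly μ hβ hx) rfl hx]
    funext i
    simp
  have hdvd : paraPoly μ m β ∣ U.charpoly := by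
    rw [(IsAlgClosed.splits (paraPoly μ m β)).eq_prod_roots_of_monic (paraPoly_monic μ m β),
      Multiset.prod_X_sub_C_dvd_iff_le_roots U.charpoly_monic.ne_zero,
      Multiset.le_iff_subset (nodup_roots_paraPoly μ hμ hβ)]
    intro x hx
    exact (mem_roots U.charpoly_monic.ne_zero).2 (hroot x (isRoot_of_mem_roots hx))
  refine eq_of_monic_of_dvd_of_natDegree_le (paraPoly_monic μ m β) U.charpoly_monic hdvd ?_
  rw [natDegree_paraPoly, Matrix.charpoly_natDegree_eq_dim, Fintype.card_fin]

/-- Both sides are affine in the upper left entry `M 0 0` of the last block, and they agree when it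
is `1` or `-1`. -/
lemma charpoly_principal_snake (hμ : ∀ s : Set Circle, s.Finite → μ sᶜ ≠ 0)
    {p : ℕ → ℕ} (hp : IsGeneratingSequence p) (m : ℕ) (M : Matrix (Fin 2) (Fin 2) ℂ) :
    (principal (snake p (Function.update (schurBlock μ) m M)) (m + 1)).charpoly =
      paraPoly μ m (M 0 0) := by
  obtain ⟨W, hW⟩ := exists_charpoly_principal_snake_eq p (schurBlock μ) m
  obtain ⟨A, B, hAB⟩ := exists_charpoly_mul_diagonal_eq W
  have h (β : ℂ) (hβ : ‖β‖ = 1) : A + C β * B = X * monicPoly μ m - C β * revPoly μ m := by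
    have h1 := charpoly_principal_snake_of_norm_eq_one μ hμ hp m hβ 1
    rwa [hW, hAB] at h1
  have h1 := h 1 norm_one
  have h2 := h (-1) (by simp)
  simp only [C_neg, C_1] at h1 h2
  have hA : A = X * monicPoly μ m :=
    mul_left_cancel₀ (two_ne_zero (α := ℂ[X])) (by linear_combination h1 + h2)
  rw [hW, hAB, paraPoly]
  linear_combination (1 - C (M 0 0)) * hA + C (M 0 0) * h1

end Charpoly

/-! ### Normalized eigenvectors -/

section Eigensystem

/-- The components `c_j` do not depend on the choice of the normalized eigenvectors. -/
lemma IsNormalizedEigensystem.first_unique {n : ℕ} {hn : 0 < n} {U : Matrix (Fin n) (Fin n) ℂ}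
    (hU : U ∈ Matrix.unitaryGroup (Fin n) ℂ) {z : Fin n → Circle} (hz : Function.Injective z)
    {v v' : Fin n → EuclideanSpace ℂ (Fin n)} {c c' : Fin n → ℝ}
    (h : IsNormalizedEigensystem hn U (fun j => (z j : ℂ)) v c)
    (h' : IsNormalizedEigensystem hn U (fun j => (z j : ℂ)) v' c') : c = c' := by
  funext j
  have hcard : Fintype.card (Fin n) = Module.finrank ℂ (EuclideanSpace ℂ (Fin n)) := by simp
  have : Nonempty (Fin n) := ⟨⟨0, hn⟩⟩
  set e := (basisOfOrthonormalOfCardEqFinrank h'.orthonormal hcard).toOrthonormalBasis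
    (by simpa using h'.orthonormal) with he
  have hev (i : Fin n) : e i = v' i := by simp [he]
  -- `v j` is orthogonal to `v' i` for `i ≠ j`, hence a multiple of `v' j`.
  have hmul : inner ℂ (v' j) (v j) • v' j = v j := by
    have hsum := e.sum_repr' (v j)
    rw [Finset.sum_eq_single j] at hsum
    · rwa [hev] at hsum
    · intro i _ hij
      have h0 := star_dotProduct_eq_zero hU (fun hh => hij (hz hh)) (h'.eigen i) (h.eigen j)
      have : inner ℂ (e i) (v j) = 0 := by
        rw [hev, EuclideanSpace.inner_eq_star_dotProduct, dotProduct_comm]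
        exact h0
      rw [this, zero_smul]
    · simp
  have hnorm : ‖inner ℂ (v' j) (v j)‖ = 1 := by
    have := congrArg norm hmul
    rwa [norm_smul, h.orthonormal.1, h'.orthonormal.1, mul_one] at this
  have hfirst := congrArg (fun w : EuclideanSpace ℂ (Fin n) => ‖w ⟨0, hn⟩‖) hmul
  simp only [PiLp.smul_apply, smul_eq_mul, norm_mul, hnorm, h.first, h'.first, one_mul,
    Complex.norm_real, Real.norm_eq_abs, abs_of_pos (h.pos j), abs_of_pos (h'.pos j)] at hfirst
  exact hfirst.symm

variable (μ : Measure Circle)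

/-- The square root of the weight at `z`, that is, of the Christoffel function
`1 / ∑_{k ≤ m} |φ_k(z)| ^ 2`. -/
def rootWeight (μ : Measure Circle) (m : ℕ) (z : Circle) : ℝ :=
  (Real.sqrt (∑ k : Fin (m + 1), ‖(orthoPoly μ k).eval (z : ℂ)‖ ^ 2))⁻¹

lemma sum_norm_orthoPoly_pos [IsProbabilityMeasure μ] (m : ℕ) (z : Circle) :
    0 < ∑ k : Fin (m + 1), ‖(orthoPoly μ k).eval (z : ℂ)‖ ^ 2 := by
  refine Finset.sum_pos' (fun _ _ => sq_nonneg _) ⟨0, Finset.mem_univ _, ?_⟩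
  simp [orthoPoly_eq, monicNorm, monicPoly_zero]

variable [IsProbabilityMeasure μ]

/-- The normalized eigenvectors are the conjugates of the row eigenvectors, divided by their
norms, which are the same for all shapes `p`. -/
lemma isNormalizedEigensystem_szegoRow (hμ : ∀ s : Set Circle, s.Finite → μ sᶜ ≠ 0)
    {p : ℕ → ℕ} (hp : IsGeneratingSequence p) {m : ℕ} {β β' : ℂ} (hβ : ‖β‖ = 1) (hβ' : ‖β'‖ = 1)
    {z : Fin (m + 1) → Circle} (hz : Function.Injective z)
    (hroot : ∀ j, (paraPoly μ m β).IsRoot (z j)) (hm : 0 < m + 1) :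
    IsNormalizedEigensystem hm
      (principal (snake p (Function.update (schurBlock μ) m !![β, 0; 0, β'])) (m + 1))
      (fun j => (z j : ℂ))
      (fun j => WithLp.toLp 2 fun i : Fin (m + 1) =>
        (rootWeight μ m (z j) : ℂ) * (starRingEnd ℂ) (szegoRow μ p (z j) i))
      (fun j => rootWeight μ m (z j)) := by
  set U := principal (snake p (Function.update (schurBlock μ) m !![β, 0; 0, β'])) (m + 1)
  have hU : U ∈ Matrix.unitaryGroup (Fin (m + 1)) ℂ :=
    principal_update_mem_unitaryGroup μ hμ p m hβ hβ'
  have heig (j : Fin (m + 1)) : U.mulVec ((rootWeight μ m (z j) : ℂ) •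
      star fun i : Fin (m + 1) => szegoRow μ p (z j) i) = (z j : ℂ) •
      ((rootWeight μ m (z j) : ℂ) • star fun i : Fin (m + 1) => szegoRow μ p (z j) i) := by
    rw [Matrix.mulVec_smul, mulVec_star_of_vecMul_eq hU (Circle.norm_coe (z j))
      (vecMul_szegoRow μ hμ hp (M := !![β, 0; 0, β']) (Circle.coe_ne_zero _) rfl (hroot j)),
      smul_comm]
  refine ⟨⟨fun j => ?_, fun i j hij => ?_⟩, heig, fun j => ?_, fun j => ?_⟩
  · have hpos := sum_norm_orthoPoly_pos μ m (z j)
    rw [EuclideanSpace.norm_eq, Real.sqrt_eq_one]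
    simp only [norm_mul, RCLike.norm_conj, norm_szegoRow μ hμ, mul_pow, ← Finset.mul_sum,
      Complex.norm_real, Real.norm_eq_abs, sq_abs]
    rw [rootWeight, inv_pow, Real.sq_sqrt hpos.le, inv_mul_cancel₀ hpos.ne']
  · refine (EuclideanSpace.inner_eq_star_dotProduct _ _).trans ((dotProduct_comm _ _).trans ?_)
    exact star_dotProduct_eq_zero hU (fun h => hij (hz h)) (heig i) (heig j)
  · exact inv_pos.2 (Real.sqrt_pos.2 (sum_norm_orthoPoly_pos μ m (z j)))
  · simp [szegoRow_zero μ hp]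

end Eigensystem

/-! ### Quadrature -/

section Quadrature

variable (μ : Measure Circle) [IsProbabilityMeasure μ]

/-- For the constant shape `p = 0` the eigenvector matrix has the entries
`c_j conj (φ_k(z_j))`. It is unitary, so its rows are orthonormal too. -/
lemma sum_rootWeight_mul_orthoPoly (hμ : ∀ s : Set Circle, s.Finite → μ sᶜ ≠ 0)
    {m : ℕ} {β : ℂ} (hβ : ‖β‖ = 1) {z : Fin (m + 1) → Circle} (hz : Function.Injective z)
    (hroot : ∀ j, (paraPoly μ m β).IsRoot (z j)) (k l : Fin (m + 1)) :
    ∑ j, ((rootWeight μ m (z j) ^ 2 : ℝ) : ℂ) * ((starRingEnd ℂ) ((orthoPoly μ k).eval (z j : ℂ)) *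
      (orthoPoly μ l).eval (z j : ℂ)) = if k = l then 1 else 0 := by
  have hp : IsGeneratingSequence fun _ => 0 := ⟨rfl, fun n => n.zero_le, fun _ => Or.inl rfl⟩
  have hon := (isNormalizedEigensystem_szegoRow μ hμ hp hβ norm_one hz hroot
    m.succ_pos).orthonormal
  set V : Matrix (Fin (m + 1)) (Fin (m + 1)) ℂ := Matrix.of fun k j =>
    (rootWeight μ m (z j) : ℂ) * (starRingEnd ℂ) ((orthoPoly μ k).eval (z j : ℂ))
  have hV : V.conjTranspose * V = 1 := by
    ext i j
    have := orthonormal_iff_ite.1 hon i j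
    rw [EuclideanSpace.inner_eq_star_dotProduct, dotProduct_comm] at this
    rw [Matrix.one_apply, ← this]
    simp [Matrix.mul_apply, dotProduct, V, szegoRow, snakeRow]
  have hV' : V * V.conjTranspose = 1 := mul_eq_one_comm.1 hV
  have h := congrFun (congrFun hV' k) l
  rw [Matrix.one_apply, Matrix.mul_apply] at h
  rw [← h]
  refine Finset.sum_congr rfl fun j _ => ?_
  simp only [V, Matrix.conjTranspose_apply, Matrix.of_apply, star_mul', RCLike.star_def,
    Complex.conj_conj, Complex.conj_ofReal]
  push_cast
  ring

/-- The discrete measure with the masses `c_j ^ 2` at `z_j` induces the inner product of `μ` on the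
polynomials of degree at most `m`. -/
lemma sum_rootWeight_eq_ip (hμ : ∀ s : Set Circle, s.Finite → μ sᶜ ≠ 0)
    {m : ℕ} {β : ℂ} (hβ : ‖β‖ = 1) {z : Fin (m + 1) → Circle} (hz : Function.Injective z)
    (hroot : ∀ j, (paraPoly μ m β).IsRoot (z j)) {f g : ℂ[X]}
    (hf : f.degree < ((m + 1 : ℕ) : WithBot ℕ)) (hg : g.degree < ((m + 1 : ℕ) : WithBot ℕ)) :
    ∑ j, ((rootWeight μ m (z j) ^ 2 : ℝ) : ℂ) * ((starRingEnd ℂ) (f.eval (z j : ℂ)) *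
      g.eval (z j : ℂ)) = ip μ f g := by
  refine monicPoly_induction μ (m + 1)
    (P := fun g => ∑ j, ((rootWeight μ m (z j) ^ 2 : ℝ) : ℂ) *
      ((starRingEnd ℂ) (f.eval (z j : ℂ)) * g.eval (z j : ℂ)) = ip μ f g) ?_ ?_ ?_ ?_ g hg
  · simp [ip_zero_right]
  · intro g₁ g₂ h₁ h₂
    rw [ip_add_right, ← h₁, ← h₂, ← Finset.sum_add_distrib]
    simp only [eval_add, mul_add]
  · intro c g h
    rw [ip_C_mul_right, ← h, Finset.mul_sum]
    refine Finset.sum_congr rfl fun j _ => ?_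
    rw [eval_mul, eval_C]
    ring
  intro l hl
  refine monicPoly_induction μ (m + 1)
    (P := fun f => ∑ j, ((rootWeight μ m (z j) ^ 2 : ℝ) : ℂ) *
      ((starRingEnd ℂ) (f.eval (z j : ℂ)) * (monicPoly μ l).eval (z j : ℂ)) =
        ip μ f (monicPoly μ l)) ?_ ?_ ?_ ?_ f hf
  · simp [ip_zero_left]
  · intro f₁ f₂ h₁ h₂
    rw [ip_add_left, ← h₁, ← h₂, ← Finset.sum_add_distrib]
    simp only [eval_add, map_add, add_mul, mul_add]
  · intro c f h
    rw [ip_C_mul_left, ← h, Finset.mul_sum]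
    refine Finset.sum_congr rfl fun j _ => ?_
    rw [eval_mul, eval_C, map_mul]
    ring
  intro k hk
  have hN (i : ℕ) : (monicNorm μ i : ℂ) ≠ 0 := by exact_mod_cast (monicNorm_pos μ hμ i).ne'
  have hΦ (i : ℕ) (x : ℂ) :
      (monicPoly μ i).eval x = monicNorm μ i * (orthoPoly μ i).eval x := by
    have := hN i
    rw [orthoPoly_eq, eval_mul, eval_C]
    push_cast
    field_simp
  have hsum := sum_rootWeight_mul_orthoPoly μ hμ hβ hz hroot ⟨k, hk⟩ ⟨l, hl⟩
  have hL : ∑ j, ((rootWeight μ m (z j) ^ 2 : ℝ) : ℂ) *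
      ((starRingEnd ℂ) ((monicPoly μ k).eval (z j : ℂ)) * (monicPoly μ l).eval (z j : ℂ)) =
      monicNorm μ k * monicNorm μ l * if k = l then 1 else 0 := by
    simp only [Fin.mk.injEq] at hsum
    rw [← hsum, Finset.mul_sum]
    refine Finset.sum_congr rfl fun j _ => ?_
    rw [hΦ, hΦ, map_mul, Complex.conj_ofReal]
    ring
  rw [hL]
  split_ifs with h
  · subst h
    rw [ip_self, mul_one, ← Complex.ofReal_mul, monicNorm,
      Real.mul_self_sqrt (integral_nonneg fun _ => by positivity)]
  · rw [mul_zero]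
    rcases lt_or_gt_of_ne h with h | h
    · exact (ip_monicPoly_monicPoly hμ l k h).symm
    · rw [← conj_ip, ip_monicPoly_monicPoly hμ k l h, map_zero]

/-- Up to conjugation of one factor, `z ^ k` with `|k| ≤ m` is a product of two polynomials of
degree at most `m`. -/
lemma exists_zpow_eq_conj_mul {m : ℕ} {k : ℤ} (h1 : -((m + 1 : ℕ) : ℤ) + 1 ≤ k)
    (h2 : k ≤ ((m + 1 : ℕ) : ℤ) - 1) : ∃ f g : ℂ[X], f.degree < ((m + 1 : ℕ) : WithBot ℕ) ∧
      g.degree < ((m + 1 : ℕ) : WithBot ℕ) ∧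
      ∀ x : Circle, (x : ℂ) ^ k = (starRingEnd ℂ) (f.eval (x : ℂ)) * g.eval (x : ℂ) := by
  have hdeg {d : ℕ} (hd : d ≤ m) : ((X : ℂ[X]) ^ d).degree < ((m + 1 : ℕ) : WithBot ℕ) := by
    rw [degree_X_pow]
    exact_mod_cast Nat.lt_succ_of_le hd
  rcases le_or_gt 0 k with hk | hk
  · obtain ⟨d, rfl⟩ := Int.eq_ofNat_of_zero_le hk
    exact ⟨X ^ 0, X ^ d, hdeg m.zero_le, hdeg (by omega), fun x => by simp⟩
  · obtain ⟨d, hd⟩ := Int.eq_ofNat_of_zero_le (neg_nonneg.2 hk.le)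
    obtain rfl : k = -(d : ℤ) := by omega
    refine ⟨X ^ d, X ^ 0, hdeg (by omega), hdeg m.zero_le, fun x => ?_⟩
    have hx : (starRingEnd ℂ) (x : ℂ) = (x : ℂ)⁻¹ := eq_inv_of_mul_eq_one_left (circle_conj_mul x)
    simp [hx]

lemma isSzegoQuadrature_rootWeight (hμ : ∀ s : Set Circle, s.Finite → μ sᶜ ≠ 0)
    {m : ℕ} {β : ℂ} (hβ : ‖β‖ = 1) {z : Fin (m + 1) → Circle} (hz : Function.Injective z)
    (hroot : ∀ j, (paraPoly μ m β).IsRoot (z j)) :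
    IsSzegoQuadrature μ (m + 1) z fun j => rootWeight μ m (z j) ^ 2 := by
  refine ⟨hz, fun L hL => ?_⟩
  suffices h : Continuous L ∧
      ∑ j, ((rootWeight μ m (z j) ^ 2 : ℝ) : ℂ) * L (z j) = ∫ x, L x ∂μ from h.2
  induction hL using Submodule.span_induction with
  | mem L hL =>
    obtain ⟨k, h1, h2, rfl⟩ := hL
    obtain ⟨f, g, hf, hg, hfg⟩ := exists_zpow_eq_conj_mul h1 h2
    simp only [hfg]
    exact ⟨continuous_ip_integrand f g, sum_rootWeight_eq_ip μ hμ hβ hz hroot hf hg⟩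
  | zero => exact ⟨continuous_zero, by simp⟩
  | add L₁ L₂ _ _ h₁ h₂ =>
    refine ⟨h₁.1.add h₂.1, ?_⟩
    simp only [Pi.add_apply, mul_add, Finset.sum_add_distrib, h₁.2, h₂.2]
    rw [integral_add (integrable_of_continuous μ h₁.1) (integrable_of_continuous μ h₂.1)]
  | smul c L _ h =>
    refine ⟨h.1.const_smul c, ?_⟩
    simp only [Pi.smul_apply, smul_eq_mul, integral_const_mul, ← h.2, Finset.mul_sum]
    exact Finset.sum_congr rfl fun j _ => by ring

/-- The zeros of `z Φ_m - β Φ_m^*`, `|β| = 1`, as a family of points of the circle. -/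
lemma exists_circle_roots_paraPoly (hμ : ∀ s : Set Circle, s.Finite → μ sᶜ ≠ 0) (m : ℕ)
    {β : ℂ} (hβ : ‖β‖ = 1) : ∃ z : Fin (m + 1) → Circle, Function.Injective z ∧
      ∀ x : ℂ, (paraPoly μ m β).IsRoot x ↔ ∃ j, (z j : ℂ) = x := by
  have hne := (paraPoly_monic μ m β).ne_zero
  have hcard : (paraPoly μ m β).roots.toFinset.card = m + 1 := by
    rw [Multiset.toFinset_card_of_nodup (nodup_roots_paraPoly μ hμ hβ), card_roots_paraPoly]
  set e := Finset.equivFinOfCardEq hcard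
  have hmem (x : ℂ) : x ∈ (paraPoly μ m β).roots.toFinset ↔ (paraPoly μ m β).IsRoot x := by
    rw [Multiset.mem_toFinset, mem_roots hne]
  have hnorm (j : Fin (m + 1)) : ‖(e.symm j : ℂ)‖ = 1 :=
    norm_eq_one_of_isRoot_paraPoly μ hμ hβ ((hmem _).1 (e.symm j).2)
  refine ⟨fun j => ⟨e.symm j, mem_sphere_zero_iff_norm.2 (hnorm j)⟩, fun i j hij => ?_,
    fun x => ⟨fun hx => ⟨e ⟨x, (hmem x).2 hx⟩, ?_⟩, ?_⟩⟩
  · exact e.symm.injective (Subtype.ext (congrArg (fun w : Circle => (w : ℂ)) hij))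
  · change ((e.symm (e ⟨x, (hmem x).2 hx⟩) : _) : ℂ) = x
    rw [e.symm_apply_apply]
  · rintro ⟨j, rfl⟩
    exact (hmem _).1 (e.symm j).2

end Quadrature

/-! ### Eigenvalues of the principal submatrices -/

lemma hasEigenvalue_toLin'_iff {n : ℕ} (A : Matrix (Fin n) (Fin n) ℂ) (x : ℂ) :
    Module.End.HasEigenvalue (Matrix.toLin' A) x ↔ A.charpoly.IsRoot x := by
  rw [Module.End.hasEigenvalue_iff_isRoot_charpoly, Matrix.charpoly_toLin']

lemma charpoly_principal_snakeMatrix (μ : Measure Circle) [IsProbabilityMeasure μ]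
    (hμ : ∀ s : Set Circle, s.Finite → μ sᶜ ≠ 0) {p : ℕ → ℕ} (hp : IsGeneratingSequence p)
    (m : ℕ) : (principal (snakeMatrix μ p) (m + 1)).charpoly = monicPoly μ (m + 1) := by
  have h := charpoly_principal_snake μ hμ hp m (schurBlock μ m)
  rw [Function.update_eq_self] at h
  rw [snakeMatrix, h, monicPoly_succ μ hμ, paraPoly]
  simp [schurBlock]

end Szego
end

theorem mainTheorem6 (μ : Measure Circle) [IsProbabilityMeasure μ]
    (hμ : ∀ s : Set Circle, s.Finite → μ sᶜ ≠ 0)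
    (p : ℕ → ℕ) (hp : Szego.IsGeneratingSequence p) (n : ℕ) (hn : 0 < n) :
    ((∀ x : ℂ, Module.End.HasEigenvalue
          (Matrix.toLin' (Szego.principal (Szego.snakeMatrix μ p) n)) x ↔
        (Szego.orthoPoly μ n).IsRoot x) ∧
      (Szego.principal (Szego.snakeMatrix μ p) n).charpoly.roots =
        (Szego.orthoPoly μ n).roots) ∧
    ∀ θ θ' : ℝ, ∃ z : Fin n → Circle,
      Function.Injective z ∧
      (∀ x : ℂ, Module.End.HasEigenvalue
          (Matrix.toLin' (Szego.truncation μ p n θ θ')) x ↔ ∃ j, (z j : ℂ) = x) ∧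
      (∃ (v : Fin n → EuclideanSpace ℂ (Fin n)) (c : Fin n → ℝ),
        Szego.IsNormalizedEigensystem hn (Szego.truncation μ p n θ θ')
          (fun j => (z j : ℂ)) v c) ∧
      ∀ (v : Fin n → EuclideanSpace ℂ (Fin n)) (c : Fin n → ℝ),
        Szego.IsNormalizedEigensystem hn (Szego.truncation μ p n θ θ')
          (fun j => (z j : ℂ)) v c →
        Szego.IsSzegoQuadrature μ n z (fun j => c j ^ 2) := by
  obtain ⟨m, rfl⟩ : ∃ m, n = m + 1 := ⟨n - 1, by omega⟩
  have hC : (((Szego.monicNorm μ (m + 1))⁻¹ : ℝ) : ℂ) ≠ 0 := by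
    exact_mod_cast inv_ne_zero (Szego.monicNorm_pos μ hμ (m + 1)).ne'
  refine ⟨⟨fun x => ?_, ?_⟩, fun θ θ' => ?_⟩
  · rw [Szego.hasEigenvalue_toLin'_iff, Szego.charpoly_principal_snakeMatrix μ hμ hp,
      Szego.orthoPoly_eq, Polynomial.IsRoot.def, Polynomial.IsRoot.def, Polynomial.eval_mul,
      Polynomial.eval_C, mul_eq_zero, or_iff_right hC]
  · rw [Szego.charpoly_principal_snakeMatrix μ hμ hp, Szego.orthoPoly_eq,
      Polynomial.roots_C_mul _ hC]
  · have hβ (t : ℝ) : ‖Complex.exp (t * Complex.I)‖ = 1 := Complex.norm_exp_ofReal_mul_I t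
    obtain ⟨z, hz, hroot⟩ := Szego.exists_circle_roots_paraPoly μ hμ m (hβ θ)
    have hroot' (j : Fin (m + 1)) := (hroot (z j)).2 ⟨j, rfl⟩
    have hsys := Szego.isNormalizedEigensystem_szegoRow μ hμ hp (hβ θ) (hβ θ') hz hroot' hn
    refine ⟨z, hz, fun x => ?_, ⟨_, _, hsys⟩, fun v c hvc => ?_⟩
    · rw [Szego.hasEigenvalue_toLin'_iff, ← hroot]
      have h := Szego.charpoly_principal_snake_of_norm_eq_one μ hμ hp m (hβ θ)
        (Complex.exp (θ' * Complex.I))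
      rw [← h]
      rfl
    · -- The weights are those of the explicit eigensystem, which do not depend on `p`.
      rw [Szego.IsNormalizedEigensystem.first_unique
        (Szego.principal_update_mem_unitaryGroup μ hμ p m (hβ θ) (hβ θ')) hz hvc hsys]
      exact Szego.isSzegoQuadrature_rootWeight μ hμ (hβ θ) hz hroot'
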